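/- Let $k$ be a field, $n\ge 2$ and $g=(a_{ij})\in \mathrm{GL}_n(k)$. Let $\mathcal S=\mathcal S(k^n,g)$ be the $(2n+4)$-dimensional $\mathbb Z$-graded $k$-algebra with basis $e_X,e_Y,\alpha_1,\dots,\alpha_n$ in degree $0$ and $\beta_1,\dots,\beta_n,\xi_X,\xi_Y$ in degree $1$, i.e. the total morphism algebra of the graded category with two objects $X,Y$, identities $e_X,e_Y$, $\alpha_i\in\mathrm{Hom}(X,Y)$, $\beta_i\in\mathrm{Hom}(Y,X)$, $\xi_X\in\mathrm{Hom}(X,X)$, $\xi_Y\in\mathrm{Hom}(Y,Y)$, in which the product is the composition and the only nonzero products of basis elements not involving $e_X,e_Y$ are given by $$\beta_i\alpha_j=a_{ij}\,\xi_X,\qquad \alpha_j\beta_i=\delta_{ij}\,\xi_Y .$$ For a $\mathbb Z$-graded $k$-algebra $A$ let $CH^{s+t}(A)\{t\}$ ($s\ge 0$, $t\in\mathbb Z$) be the space of $k$-linear maps $A^{\otimes s}\to A$ of degree $t$, with the Hochschild differential (with Koszul signs) $$(\delta f)(a_0,\dots,a_s)=(-1)^{t\deg a_0}a_0f(a_1,\dots,a_s)+\sum_{i=0}^{s-1}(-1)^{i+1}f(a_0,\dots,a_ia_{i+1},\dots,a_s)+(-1)^{s+1}f(a_0,\dots,a_{s-1})a_s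 ,$$ and let $HH^{m}(A)\{t\}$ be the cohomology of $CH^{\bullet}(A)\{t\}$ at $CH^m(A)\{t\}$ (zero if $m<t$). Then for all $m,t\in\mathbb Z$ with $t<-m$ one has $$HH^m(\mathcal S)\{t\}=0 .$$ If in addition $n\ge 3$, or $g\ne\lambda\cdot\mathrm{id}$ for every $\lambda\in k^*$, or $\mathrm{char}(k)\ne 2$, then $$HH^1(\mathcal S)\{-1\}=0 .$$ -/

import Mathlib

set_option maxSynthPendingDepth 3

/-- The total morphism algebra of the graded category with two objects `X`, `Y`, where
`Hom(X,Y) = V`, `Hom(Y,X) = V^∨`, `Hom(X,X) = R id_X ⊕ R ξ_X`, `Hom(Y,Y) = R id_Y ⊕ R ξ_Y`,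
attached to an endomorphism `g` of `V`. -/
@[ext]
structure SphAlg {R V : Type*} [CommRing R] [AddCommGroup V] [Module R V] (g : V →ₗ[R] V) where
  /-- coefficient of `id_X` -/
  idX : R
  /-- coefficient of `id_Y` -/
  idY : R
  /-- component in `Hom(X,Y) = V` -/
  hXY : V
  /-- component in `Hom(Y,X) = V^∨` -/
  hYX : Module.Dual R V
  /-- coefficient of `ξ_X` -/
  xiX : R
  /-- coefficient of `ξ_Y` -/
  xiY : R

namespace SphAlg

variable {R V : Type*} [CommRing R] [AddCommGroup V] [Module R V] {g : V →ₗ[R] V}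

instance : Zero (SphAlg g) := ⟨⟨0, 0, 0, 0, 0, 0⟩⟩
instance : Add (SphAlg g) := ⟨fun a b =>
  ⟨a.idX + b.idX, a.idY + b.idY, a.hXY + b.hXY, a.hYX + b.hYX, a.xiX + b.xiX, a.xiY + b.xiY⟩⟩
instance : Neg (SphAlg g) := ⟨fun a => ⟨-a.idX, -a.idY, -a.hXY, -a.hYX, -a.xiX, -a.xiY⟩⟩
instance : SMul R (SphAlg g) := ⟨fun r a =>
  ⟨r * a.idX, r * a.idY, r • a.hXY, r • a.hYX, r * a.xiX, r * a.xiY⟩⟩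
instance : One (SphAlg g) := ⟨⟨1, 1, 0, 0, 0, 0⟩⟩

/-- The product `a * b` is the composition `a ∘ b` (first `b`, then `a`), with
`v^* ∘ v = ⟨v^*, g v⟩ ξ_X` and `v ∘ v^* = ⟨v^*, v⟩ ξ_Y`. -/
instance : Mul (SphAlg g) := ⟨fun a b =>
  { idX := a.idX * b.idX
    idY := a.idY * b.idY
    hXY := a.idY • b.hXY + b.idX • a.hXY
    hYX := a.idX • b.hYX + b.idY • a.hYX
    xiX := a.idX * b.xiX + a.xiX * b.idX + a.hYX (g b.hXY)
    xiY := a.idY * b.xiY + a.xiY * b.idY + b.hYX a.hXY }⟩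

@[simp] lemma zero_idX : (0 : SphAlg g).idX = 0 := rfl
@[simp] lemma zero_idY : (0 : SphAlg g).idY = 0 := rfl
@[simp] lemma zero_hXY : (0 : SphAlg g).hXY = 0 := rfl
@[simp] lemma zero_hYX : (0 : SphAlg g).hYX = 0 := rfl
@[simp] lemma zero_xiX : (0 : SphAlg g).xiX = 0 := rfl
@[simp] lemma zero_xiY : (0 : SphAlg g).xiY = 0 := rfl
@[simp] lemma one_idX : (1 : SphAlg g).idX = 1 := rfl
@[simp] lemma one_idY : (1 : SphAlg g).idY = 1 := rfl
@[simp] lemma one_hXY : (1 : SphAlg g).hXY = 0 := rfl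
@[simp] lemma one_hYX : (1 : SphAlg g).hYX = 0 := rfl
@[simp] lemma one_xiX : (1 : SphAlg g).xiX = 0 := rfl
@[simp] lemma one_xiY : (1 : SphAlg g).xiY = 0 := rfl
@[simp] lemma add_idX (a b : SphAlg g) : (a + b).idX = a.idX + b.idX := rfl
@[simp] lemma add_idY (a b : SphAlg g) : (a + b).idY = a.idY + b.idY := rfl
@[simp] lemma add_hXY (a b : SphAlg g) : (a + b).hXY = a.hXY + b.hXY := rfl
@[simp] lemma add_hYX (a b : SphAlg g) : (a + b).hYX = a.hYX + b.hYX := rfl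
@[simp] lemma add_xiX (a b : SphAlg g) : (a + b).xiX = a.xiX + b.xiX := rfl
@[simp] lemma add_xiY (a b : SphAlg g) : (a + b).xiY = a.xiY + b.xiY := rfl
@[simp] lemma neg_idX (a : SphAlg g) : (-a).idX = -a.idX := rfl
@[simp] lemma neg_idY (a : SphAlg g) : (-a).idY = -a.idY := rfl
@[simp] lemma neg_hXY (a : SphAlg g) : (-a).hXY = -a.hXY := rfl
@[simp] lemma neg_hYX (a : SphAlg g) : (-a).hYX = -a.hYX := rfl
@[simp] lemma neg_xiX (a : SphAlg g) : (-a).xiX = -a.xiX := rfl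
@[simp] lemma neg_xiY (a : SphAlg g) : (-a).xiY = -a.xiY := rfl
@[simp] lemma smul_idX (r : R) (a : SphAlg g) : (r • a).idX = r * a.idX := rfl
@[simp] lemma smul_idY (r : R) (a : SphAlg g) : (r • a).idY = r * a.idY := rfl
@[simp] lemma smul_hXY (r : R) (a : SphAlg g) : (r • a).hXY = r • a.hXY := rfl
@[simp] lemma smul_hYX (r : R) (a : SphAlg g) : (r • a).hYX = r • a.hYX := rfl
@[simp] lemma smul_xiX (r : R) (a : SphAlg g) : (r • a).xiX = r * a.xiX := rfl
@[simp] lemma smul_xiY (r : R) (a : SphAlg g) : (r • a).xiY = r * a.xiY := rfl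
@[simp] lemma mul_idX (a b : SphAlg g) : (a * b).idX = a.idX * b.idX := rfl
@[simp] lemma mul_idY (a b : SphAlg g) : (a * b).idY = a.idY * b.idY := rfl
@[simp] lemma mul_hXY (a b : SphAlg g) : (a * b).hXY = a.idY • b.hXY + b.idX • a.hXY := rfl
@[simp] lemma mul_hYX (a b : SphAlg g) : (a * b).hYX = a.idX • b.hYX + b.idY • a.hYX := rfl
@[simp] lemma mul_xiX (a b : SphAlg g) :
    (a * b).xiX = a.idX * b.xiX + a.xiX * b.idX + a.hYX (g b.hXY) := rfl
@[simp] lemma mul_xiY (a b : SphAlg g) :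
    (a * b).xiY = a.idY * b.xiY + a.xiY * b.idY + b.hYX a.hXY := rfl

instance : AddCommGroup (SphAlg g) where
  add_assoc a b c := by ext <;> simp [add_assoc]
  zero_add a := by ext <;> simp
  add_zero a := by ext <;> simp
  add_comm a b := by ext <;> simp [add_comm]
  neg_add_cancel a := by ext <;> simp
  nsmul := nsmulRec
  zsmul := zsmulRec

instance : Ring (SphAlg g) where
  left_distrib a b c := by ext <;> simp <;> first | ring | module
  right_distrib a b c := by ext <;> simp <;> first | ring | module
  zero_mul a := by ext <;> simp
  mul_zero a := by ext <;> simp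
  one_mul a := by ext <;> simp
  mul_one a := by ext <;> simp
  mul_assoc a b c := by ext <;> simp <;> first | ring | module
  zsmul := zsmulRec
  neg_add_cancel a := neg_add_cancel a

instance : Module R (SphAlg g) where
  one_smul a := by ext <;> simp
  mul_smul r s a := by ext <;> simp [mul_assoc, mul_smul]
  smul_zero r := by ext <;> simp
  smul_add r a b := by ext <;> simp [mul_add]
  add_smul r s a := by ext <;> simp [add_mul, add_smul]
  zero_smul a := by ext <;> simp

instance : Algebra R (SphAlg g) :=
  Algebra.ofModule
    (fun r a b => by ext <;> simp <;> first | ring | module)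
    (fun r a b => by ext <;> simp <;> first | ring | module)

/-- The grading by morphism degree: `Hom^0` is spanned by `id_X`, `id_Y` and `Hom(X,Y)`,
`Hom^1` by `Hom(Y,X)`, `ξ_X` and `ξ_Y`, and there is nothing in other degrees. -/
def grading (g : V →ₗ[R] V) (d : ℤ) : Submodule R (SphAlg g) where
  carrier := {a | (d ≠ 0 → a.idX = 0 ∧ a.idY = 0 ∧ a.hXY = 0) ∧
    (d ≠ 1 → a.hYX = 0 ∧ a.xiX = 0 ∧ a.xiY = 0)}
  zero_mem' := by simp
  add_mem' := by
    rintro a b ⟨ha, ha'⟩ ⟨hb, hb'⟩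
    refine ⟨fun h => ?_, fun h => ?_⟩
    · simp [ha h, hb h]
    · simp [ha' h, hb' h]
  smul_mem' := by
    rintro r a ⟨ha, ha'⟩
    refine ⟨fun h => ?_, fun h => ?_⟩
    · simp [ha h]
    · simp [ha' h]

lemma mem_grading {d : ℤ} {a : SphAlg g} : a ∈ grading g d ↔
    (d ≠ 0 → a.idX = 0 ∧ a.idY = 0 ∧ a.hXY = 0) ∧
    (d ≠ 1 → a.hYX = 0 ∧ a.xiX = 0 ∧ a.xiY = 0) := Iff.rfl

/-- The degree `0` part of an element. -/
def part0 (g : V →ₗ[R] V) : SphAlg g →ₗ[R] grading g 0 where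
  toFun a := ⟨⟨a.idX, a.idY, a.hXY, 0, 0, 0⟩, by simp [mem_grading]⟩
  map_add' a b := by ext <;> simp
  map_smul' r a := by ext <;> simp

/-- The degree `1` part of an element. -/
def part1 (g : V →ₗ[R] V) : SphAlg g →ₗ[R] grading g 1 where
  toFun a := ⟨⟨0, 0, 0, a.hYX, a.xiX, a.xiY⟩, by simp [mem_grading]⟩
  map_add' a b := by ext <;> simp
  map_smul' r a := by ext <;> simp

instance : SetLike.GradedMonoid (grading g) where
  one_mem := by simp [mem_grading]
  mul_mem := by
    intro i j a b ha hb
    rw [mem_grading] at *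
    by_cases hi0 : i = 0 <;> by_cases hi1 : i = 1 <;> by_cases hj0 : j = 0 <;>
      by_cases hj1 : j = 1 <;> simp_all

instance : DirectSum.Decomposition (grading g) :=
  DirectSum.Decomposition.ofLinearMap (grading g)
    (DirectSum.lof R ℤ (fun d => grading g d) 0 ∘ₗ part0 g +
      DirectSum.lof R ℤ (fun d => grading g d) 1 ∘ₗ part1 g)
    (by
      ext a <;> simp [part0, part1])
    (by
      refine DirectSum.linearMap_ext _ fun d => ?_
      ext1 ⟨a, ha⟩
      rw [mem_grading] at ha
      simp only [LinearMap.comp_apply, LinearMap.add_apply, DirectSum.coeLinearMap_lof,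
        LinearMap.id_apply]
      by_cases h0 : d = 0
      · subst h0
        have h : part1 g a = 0 := by ext <;> simp [part1, ha.2 (by simp)]
        have h' : part0 g a = ⟨a, ha⟩ := by ext <;> simp [part0, ha.2 (by simp)]
        rw [h, h', map_zero, add_zero]
      · by_cases h1 : d = 1
        · subst h1
          have h : part0 g a = 0 := by ext <;> simp [part0, ha.1 (by simp)]
          have h' : part1 g a = ⟨a, ha⟩ := by ext <;> simp [part1, ha.1 (by simp)]
          rw [h, h', map_zero, zero_add]
        · have h : part0 g a = 0 := by ext <;> simp [part0, ha.1 h0]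
          have h' : part1 g a = 0 := by ext <;> simp [part1, ha.2 h1]
          have h2 : (⟨a, ha⟩ : grading g d) = 0 := by
            ext <;> simp [ha.1 h0, ha.2 h1]
          rw [h, h', h2, map_zero, map_zero, map_zero, add_zero])

instance : GradedAlgebra (grading g) where

end SphAlg

namespace Hochschild

section

variable {k A : Type*} [CommRing k] [Ring A] [Algebra k A]

/-- All `k`-linear maps `A^{⊗ s} → A`. -/
abbrev Cochain (k A : Type*) [CommRing k] [Ring A] [Algebra k A] (s : ℕ) :=
  MultilinearMap k (fun _ : Fin s => A) A

/-- For `A = ⨁ 𝒜 d`, the `k`-linear map which is multiplication by `(-1)^{t d}` on `𝒜 d`. -/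
def koszulSign (𝒜 : ℤ → Submodule k A) [GradedAlgebra 𝒜] (t : ℤ) : A →ₗ[k] A :=
  DirectSum.toModule k ℤ A (fun d => ((t * d).negOnePow : ℤ) • (𝒜 d).subtype) ∘ₗ
    (DirectSum.decomposeLinearEquiv 𝒜).toLinearMap

lemma koszulSign_apply (𝒜 : ℤ → Submodule k A) [GradedAlgebra 𝒜] (t : ℤ) {d : ℤ} {a : A}
    (ha : a ∈ 𝒜 d) : koszulSign 𝒜 t a = ((t * d).negOnePow : ℤ) • a := by
  simp only [koszulSign, LinearMap.comp_apply, LinearEquiv.coe_coe,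
    DirectSum.decomposeLinearEquiv_apply, DirectSum.decompose_of_mem 𝒜 ha]
  exact DirectSum.toModule_lof (M := fun d => 𝒜 d) k d ⟨a, ha⟩

lemma koszulSign_mul (𝒜 : ℤ → Submodule k A) [GradedAlgebra 𝒜] (t : ℤ) (a b : A) :
    koszulSign 𝒜 t (a * b) = koszulSign 𝒜 t a * koszulSign 𝒜 t b := by
  induction a using DirectSum.Decomposition.inductionOn 𝒜 with
  | zero => simp
  | add a a' h h' => simp [add_mul, h, h']
  | @homogeneous d a =>
    induction b using DirectSum.Decomposition.inductionOn 𝒜 with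
    | zero => simp
    | add b b' h h' => simp [mul_add, h, h']
    | @homogeneous e b =>
      rw [koszulSign_apply 𝒜 t a.2, koszulSign_apply 𝒜 t b.2,
        koszulSign_apply 𝒜 t (SetLike.mul_mem_graded a.2 b.2), mul_add, Int.negOnePow_add,
        Units.val_mul, smul_mul_smul_comm]

lemma contractNth_update {s : ℕ} (i : Fin s) (a : Fin (s + 1) → A) (j : Fin (s + 1)) :
    ∃ (p : Fin s) (L : A →ₗ[k] A), ∀ x,
      i.castSucc.contractNth (· * ·) (Function.update a j x) =
        Function.update (i.castSucc.contractNth (· * ·) a) p (L x) := by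
  have hi := i.2
  have hj := j.2
  rcases lt_trichotomy (j : ℕ) i with h | h | h
  · refine ⟨⟨j, by lia⟩, LinearMap.id, fun x => ?_⟩
    funext q
    simp only [Fin.contractNth, Function.update_apply, Fin.ext_iff, Fin.val_castSucc, Fin.val_succ,
      LinearMap.id_apply]
    grind
  · refine ⟨i, LinearMap.mulRight k (a i.succ), fun x => ?_⟩
    funext q
    simp only [Fin.contractNth, Function.update_apply, Fin.ext_iff, Fin.val_castSucc, Fin.val_succ,
      LinearMap.mulRight_apply]
    rcases lt_trichotomy (q : ℕ) i with h' | h' | h'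
    · grind
    · obtain rfl := Fin.ext h'
      simp [h]
    · grind
  · by_cases h2 : (j : ℕ) = i + 1
    · refine ⟨i, LinearMap.mulLeft k (a i.castSucc), fun x => ?_⟩
      funext q
      simp only [Fin.contractNth, Function.update_apply, Fin.ext_iff, Fin.val_castSucc,
        Fin.val_succ, LinearMap.mulLeft_apply]
      rcases lt_trichotomy (q : ℕ) i with h' | h' | h'
      · grind
      · obtain rfl := Fin.ext h'
        simp [h2]
      · grind
    · refine ⟨⟨j - 1, by lia⟩, LinearMap.id, fun x => ?_⟩
      funext q
      simp only [Fin.contractNth, Function.update_apply, Fin.ext_iff, Fin.val_castSucc,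
        Fin.val_succ, LinearMap.id_apply]
      grind

/-- `(a₀, …, a_s) ↦ (-1)^{t |a₀|} a₀ f(a₁, …, a_s)`. -/
def firstFace (𝒜 : ℤ → Submodule k A) [GradedAlgebra 𝒜] (t : ℤ) {s : ℕ} (f : Cochain k A s) :
    Cochain k A (s + 1) :=
  LinearMap.uncurryLeft (R := k) (M := fun _ : Fin (s + 1) => A)
    { toFun := fun a => (LinearMap.mulLeft k (koszulSign 𝒜 t a)).compMultilinearMap f
      map_add' := fun a b => by ext; simp [add_mul]
      map_smul' := fun r a => by ext; simp }

/-- `(a₀, …, a_s) ↦ f(a₀, …, a_i a_{i+1}, …, a_s)`. -/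
def innerFace {s : ℕ} (i : Fin s) (f : Cochain k A s) : Cochain k A (s + 1) :=
  MultilinearMap.mk' (fun a => f (i.castSucc.contractNth (· * ·) a))
    (fun a j x y => by
      obtain ⟨p, L, h⟩ := contractNth_update (k := k) i a j
      simp [h])
    (fun a j c x => by
      obtain ⟨p, L, h⟩ := contractNth_update (k := k) i a j
      simp [h])

/-- `(a₀, …, a_s) ↦ f(a₀, …, a_{s-1}) a_s`. -/
def lastFace {s : ℕ} (f : Cochain k A s) : Cochain k A (s + 1) :=
  MultilinearMap.uncurryRight (R := k) (M := fun _ : Fin (s + 1) => A)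
    ((LinearMap.mul k A).compMultilinearMap f)

lemma firstFace_apply (𝒜 : ℤ → Submodule k A) [GradedAlgebra 𝒜] (t : ℤ) {s : ℕ}
    (f : Cochain k A s) (a : Fin (s + 1) → A) :
    firstFace 𝒜 t f a = koszulSign 𝒜 t (a 0) * f (fun i => a i.succ) := rfl

lemma innerFace_apply {s : ℕ} (i : Fin s) (f : Cochain k A s) (a : Fin (s + 1) → A) :
    innerFace i f a = f (i.castSucc.contractNth (· * ·) a) := rfl

lemma lastFace_apply {s : ℕ} (f : Cochain k A s) (a : Fin (s + 1) → A) :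
    lastFace f a = f (fun i => a i.castSucc) * a (Fin.last s) := rfl

/-- The Hochschild differential on cochains of internal degree `t`, with Koszul signs:
`(δf)(a₀, …, a_s) = (-1)^{t |a₀|} a₀ f(a₁, …, a_s)
  + ∑_{i < s} (-1)^{i+1} f(a₀, …, a_i a_{i+1}, …, a_s) + (-1)^{s+1} f(a₀, …, a_{s-1}) a_s`. -/
def differential (𝒜 : ℤ → Submodule k A) [GradedAlgebra 𝒜] (t : ℤ) (s : ℕ) :
    Cochain k A s →ₗ[k] Cochain k A (s + 1) where
  toFun f := firstFace 𝒜 t f + ∑ i : Fin s, (-1 : ℤ) ^ ((i : ℕ) + 1) • innerFace i f +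
    (-1 : ℤ) ^ (s + 1) • lastFace f
  map_add' f f' := by
    ext a
    simp only [add_apply, sum_apply, smul_apply,
      firstFace_apply, innerFace_apply, lastFace_apply, mul_add, add_mul, smul_add,
      Finset.sum_add_distrib]
    abel
  map_smul' c f := by
    ext a
    simp only [add_apply, sum_apply, smul_apply,
      firstFace_apply, innerFace_apply, lastFace_apply, RingHom.id_apply, smul_add,
      Finset.smul_sum, mul_smul_comm, smul_mul_assoc, smul_comm c]

/-- The space `CH^{s+t}(A){t}` of `k`-linear maps `A^{⊗ s} → A` of degree `t`. -/
def homogeneousCochains (𝒜 : ℤ → Submodule k A) (t : ℤ) (s : ℕ) : Submodule k (Cochain k A s) where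
  carrier := {f | ∀ (d : Fin s → ℤ) (a : Fin s → A), (∀ i, a i ∈ 𝒜 (d i)) →
    f a ∈ 𝒜 (∑ i, d i + t)}
  zero_mem' _ _ _ := zero_mem _
  add_mem' hf hf' d a h := add_mem (hf d a h) (hf' d a h)
  smul_mem' c _ hf d a h := Submodule.smul_mem _ c (hf d a h)

/-- Cocycles among the linear maps `A^{⊗ s} → A` of degree `t`. -/
def cocycles (𝒜 : ℤ → Submodule k A) [GradedAlgebra 𝒜] (t : ℤ) (s : ℕ) :
    Submodule k (Cochain k A s) :=
  homogeneousCochains 𝒜 t s ⊓ LinearMap.ker (differential 𝒜 t s)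

/-- Coboundaries of linear maps `A^{⊗ (s-1)} → A` of degree `t`; zero if `s = 0`. -/
def coboundaries (𝒜 : ℤ → Submodule k A) [GradedAlgebra 𝒜] (t : ℤ) :
    (s : ℕ) → Submodule k (Cochain k A s)
  | 0 => ⊥
  | s + 1 => (homogeneousCochains 𝒜 t s).map (differential 𝒜 t s)

/-- The piece of Hochschild cohomology of the graded algebra `A = ⨁ 𝒜 d` that comes from linear
maps `A^{⊗ s} → A` of degree `t`. -/
abbrev cohomology (𝒜 : ℤ → Submodule k A) [GradedAlgebra 𝒜] (t : ℤ) (s : ℕ) :=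
  cocycles 𝒜 t s ⧸ (coboundaries 𝒜 t s).submoduleOf (cocycles 𝒜 t s)

/-- `HH^m(A){t}`: the cohomology at the linear maps `A^{⊗ s} → A` of degree `t` with `s + t = m`;
it is zero if `m - t` is negative. -/
def HH (𝒜 : ℤ → Submodule k A) [GradedAlgebra 𝒜] (m t : ℤ) : Type _ :=
  match m - t with
  | Int.ofNat s => cohomology 𝒜 t s
  | Int.negSucc _ => PUnit

/-! The differential squares to zero and preserves the internal degree. -/

/-- All faces, numbered from `0` to `s + 1`. -/
def face (𝒜 : ℤ → Submodule k A) [GradedAlgebra 𝒜] (t : ℤ) {s : ℕ} (i : Fin (s + 2))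
    (f : Cochain k A s) : Cochain k A (s + 1) :=
  Fin.cases (firstFace 𝒜 t f) (Fin.lastCases (lastFace f) (fun j => innerFace j f)) i

lemma face_zero (𝒜 : ℤ → Submodule k A) [GradedAlgebra 𝒜] (t : ℤ) {s : ℕ} (f : Cochain k A s) :
    face 𝒜 t 0 f = firstFace 𝒜 t f := rfl

lemma face_inner (𝒜 : ℤ → Submodule k A) [GradedAlgebra 𝒜] (t : ℤ) {s : ℕ} (f : Cochain k A s)
    (i : Fin s) : face 𝒜 t i.castSucc.succ f = innerFace i f := by
  simp only [face, Fin.cases_succ, Fin.lastCases_castSucc]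

lemma face_last (𝒜 : ℤ → Submodule k A) [GradedAlgebra 𝒜] (t : ℤ) {s : ℕ} (f : Cochain k A s) :
    face 𝒜 t (Fin.last s).succ f = lastFace f := by
  simp only [face, Fin.cases_succ, Fin.lastCases_last]

lemma differential_eq (𝒜 : ℤ → Submodule k A) [GradedAlgebra 𝒜] (t : ℤ) {s : ℕ}
    (f : Cochain k A s) :
    differential 𝒜 t s f = ∑ i : Fin (s + 2), (-1 : ℤ) ^ (i : ℕ) • face 𝒜 t i f := by
  rw [Fin.sum_univ_succ, Fin.sum_univ_castSucc]
  simp only [face_zero, face_inner, face_last, differential]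
  simp [add_assoc]

lemma contractNth_contractNth {s : ℕ} (p q : Fin s) (h : p ≤ q) (a : Fin (s + 2) → A) :
    p.castSucc.contractNth (· * ·) (q.succ.castSucc.contractNth (· * ·) a) =
      q.castSucc.contractNth (· * ·) (p.castSucc.castSucc.contractNth (· * ·) a) := by
  have h' : (p : ℕ) ≤ q := h
  funext r
  simp only [Fin.contractNth, Fin.val_castSucc, Fin.val_succ]
  split_ifs <;> first | lia | rfl | simp [mul_assoc]

lemma face_face (𝒜 : ℤ → Submodule k A) [GradedAlgebra 𝒜] (t : ℤ) {s : ℕ}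
    (f : Cochain k A s) (i j : Fin (s + 2)) (h : i ≤ j) :
    face 𝒜 t j.succ (face 𝒜 t i f) = face 𝒜 t i.castSucc (face 𝒜 t j f) := by
  ext a
  induction i using Fin.cases with
  | zero =>
    rw [Fin.castSucc_zero, face_zero, face_zero, firstFace_apply]
    induction j using Fin.cases with
    | zero =>
      have : (0 : Fin (s + 2)).succ = (0 : Fin (s + 1)).castSucc.succ := rfl
      rw [this, face_inner, face_zero, innerFace_apply, firstFace_apply, firstFace_apply,
        ← mul_assoc, ← koszulSign_mul]
      rfl
    | succ j =>
      induction j using Fin.lastCases with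
      | last =>
        rw [show (Fin.last s).succ.succ = (Fin.last (s + 1)).succ from rfl, face_last, face_last,
          lastFace_apply, lastFace_apply, firstFace_apply, mul_assoc]
        rfl
      | cast q =>
        rw [show q.castSucc.succ.succ = q.succ.castSucc.succ from rfl, face_inner, face_inner,
          innerFace_apply, innerFace_apply, firstFace_apply]
        congr 1
        congr 1
        funext r
        simp [Fin.contractNth]
  | succ i =>
    induction j using Fin.cases with
    | zero => simp at h
    | succ j =>
      have h' := Fin.succ_le_succ_iff.1 h
      induction j using Fin.lastCases with
      | last =>
        rw [face_last, show (Fin.last s).succ.succ = (Fin.last (s + 1)).succ from rfl, face_last,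
          lastFace_apply]
        induction i using Fin.lastCases with
        | last =>
          rw [face_last, show (Fin.last s).succ.castSucc = (Fin.last s).castSucc.succ from rfl,
            face_inner, innerFace_apply, lastFace_apply, lastFace_apply, mul_assoc]
          congr 1
          · congr 1
            funext r
            simp [Fin.contractNth]
          · simp [Fin.contractNth]
        | cast p =>
          rw [face_inner, show p.castSucc.succ.castSucc = p.castSucc.castSucc.succ from rfl,
            face_inner, innerFace_apply, innerFace_apply, lastFace_apply]
          congr 1
          simp only [Fin.contractNth, Fin.val_castSucc, Fin.val_last]
          have := p.2
          split_ifs <;> first | lia | rfl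
      | cast q =>
        induction i using Fin.lastCases with
        | last =>
          have := Fin.le_def.1 h'
          simp at this
          have := q.2
          lia
        | cast p =>
          rw [show q.castSucc.succ.succ = q.succ.castSucc.succ from rfl, face_inner, face_inner,
            show p.castSucc.succ.castSucc = p.castSucc.castSucc.succ from rfl, face_inner,
            face_inner]
          simp only [innerFace_apply]
          rw [contractNth_contractNth p q h']

theorem differential_differential (𝒜 : ℤ → Submodule k A) [GradedAlgebra 𝒜] (t : ℤ) {s : ℕ}
    (f : Cochain k A s) : differential 𝒜 t (s + 1) (differential 𝒜 t s f) = 0 := by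
  have hf (j : Fin (s + 3)) : face 𝒜 t j (differential 𝒜 t s f) =
      ∑ i : Fin (s + 2), (-1 : ℤ) ^ (i : ℕ) • face 𝒜 t j (face 𝒜 t i f) := by
    rw [differential_eq]
    ext a
    induction j using Fin.cases with
    | zero =>
      simp only [face_zero, firstFace_apply, sum_apply, smul_apply, Finset.mul_sum,
        mul_smul_comm]
    | succ j =>
      induction j using Fin.lastCases with
      | last => simp only [face_last, lastFace_apply, sum_apply, smul_apply, Finset.sum_mul,
          smul_mul_assoc]
      | cast q => simp only [face_inner, innerFace_apply, sum_apply, smul_apply]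
  rw [differential_eq]
  simp only [hf, Finset.smul_sum, smul_smul]
  rw [← Finset.sum_product', Finset.univ_product_univ]
  let P := Fin (s + 3) × Fin (s + 2)
  let S : Finset P := {x : P | (x.1 : ℕ) ≤ (x.2 : ℕ)}
  rw [← Finset.sum_add_sum_compl S, ← eq_neg_iff_add_eq_zero, ← Finset.sum_neg_distrib]
  refine Finset.sum_bij
    (fun x hx => (x.2.succ, x.1.castLT (lt_of_le_of_lt (Finset.mem_filter.mp hx).2 x.2.2)))
    ?_ ?_ ?_ ?_
  · intro x hx
    simp only [S, Finset.mem_filter_univ, Finset.mem_compl, Fin.val_succ, Fin.val_castLT] at hx ⊢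
    lia
  · rintro ⟨i, j⟩ hx ⟨i', j'⟩ hx' h
    have h1 := congrArg (fun x => (x.1 : ℕ)) h
    have h2 := congrArg (fun x => (x.2 : ℕ)) h
    simp only [Fin.val_succ, Fin.val_castLT] at h1 h2
    exact Prod.ext (Fin.ext h2) (Fin.ext (by lia))
  · rintro ⟨i, j⟩ hx
    simp only [S, Finset.mem_filter_univ, Finset.mem_compl, not_le] at hx
    have := i.2
    refine ⟨(j.castSucc, ⟨i - 1, by lia⟩), ?_, ?_⟩
    · simp only [S, Finset.mem_filter_univ, Fin.val_castSucc]
      lia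
    · refine Prod.ext (Fin.ext ?_) rfl
      simp only [Fin.val_succ]
      lia
  · rintro ⟨i, j⟩ hx
    simp only [S, Finset.mem_filter_univ] at hx
    have := face_face 𝒜 t f (i.castLT (lt_of_le_of_lt hx j.2)) j hx
    simp only [this, Fin.castSucc_castLT, Fin.val_succ, Fin.val_castLT, ← neg_smul]
    congr 1
    ring

lemma sum_contractNth {s : ℕ} (p : Fin s) (d : Fin (s + 1) → ℤ) :
    ∑ i, p.castSucc.contractNth (· + ·) d i = ∑ i, d i := by
  induction s with
  | zero => exact p.elim0
  | succ s ih =>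
    rw [Fin.sum_univ_succ, Fin.sum_univ_succ d]
    induction p using Fin.cases with
    | zero =>
      rw [Fin.sum_univ_succ (fun i : Fin (s + 1) => d i.succ), ← add_assoc]
      congr 1
    | succ p =>
      rw [← ih p (fun i => d i.succ)]
      congr 1
      refine Finset.sum_congr rfl fun i _ => ?_
      simp [Fin.contractNth]

lemma differential_mem (𝒜 : ℤ → Submodule k A) [GradedAlgebra 𝒜] (t : ℤ) {s : ℕ}
    {f : Cochain k A s} (hf : f ∈ homogeneousCochains 𝒜 t s) :
    differential 𝒜 t s f ∈ homogeneousCochains 𝒜 t (s + 1) := by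
  rw [differential_eq]
  refine Submodule.sum_mem _ fun i _ => zsmul_mem ?_ _
  intro d a h
  induction i using Fin.cases with
  | zero =>
    rw [face_zero, firstFace_apply, koszulSign_apply 𝒜 t (h 0), Fin.sum_univ_succ, add_assoc]
    exact SetLike.mul_mem_graded (zsmul_mem (h 0) _) (hf (fun i => d i.succ) _ fun i => h i.succ)
  | succ i =>
    induction i using Fin.lastCases with
    | last =>
      rw [face_last, lastFace_apply, Fin.sum_univ_castSucc, add_right_comm]
      exact SetLike.mul_mem_graded (hf (fun i => d i.castSucc) _ fun i => h i.castSucc) (h _)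
    | cast p =>
      rw [face_inner, innerFace_apply]
      have hd : ∑ i, d i = ∑ i, p.castSucc.contractNth (· + ·) d i := (sum_contractNth p d).symm
      rw [hd]
      refine hf _ _ fun q => ?_
      simp only [Fin.contractNth]
      split_ifs
      · exact h _
      · exact SetLike.mul_mem_graded (h _) (h _)
      · exact h _

theorem coboundaries_le_cocycles (𝒜 : ℤ → Submodule k A) [GradedAlgebra 𝒜] (t : ℤ) (s : ℕ) :
    coboundaries 𝒜 t s ≤ cocycles 𝒜 t s := by
  cases s with
  | zero => exact bot_le
  | succ s =>
    rintro _ ⟨f, hf, rfl⟩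
    exact ⟨differential_mem 𝒜 t hf, differential_differential 𝒜 t f⟩

end

end Hochschild

/-! The cochains of degree $t$ form the Hochschild complex of $\mathcal S$ with coefficients in
$\mathcal S$ itself, shifted by $t$ and with the left action twisted by the Koszul sign. As a
bimodule $\mathcal S$ is filtered with six layers: the two identity components, then $V$ and
$V^\vee$, then the two $\xi$ components. On each layer both actions are through the characters
$\chi,\psi\in\{\varepsilon_X,\varepsilon_Y\}$, so its cohomology in degree $s$ is a graded piece of
$\mathrm{Ext}^s(S_\psi,S_\chi)$ between one-dimensional modules.

These Ext groups behave as over a Koszul algebra: they should live only where the path length equals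
$s$. Arrows alternate between internal degrees 0 and 1, so a path of degree $d$ between given
objects has length $2d+c$ with a fixed $c$. Only one half is needed, vanishing for $s<2d+c$
(`Target.linear`). It is proved by dimension shifting along projective covers. The radical of a
projective is an extension of simples by a two-dimensional uniserial module, and the syzygy of such
a module is again of this shape. Nondegeneracy of the pairings and $\dim V\ge 2$ keep the induction
going.

With $s=m-t$, the condition $t<-m$ reads $s<-2t$, and then all six layers are acyclic
(`acyclic_of_lt`). For $m=1$, $t=-1$ one has $s=2$, and only the two identity layers escape the
bound. There a cocycle component is a coboundary as soon as its values on composable pairs of arrows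
are a multiple of the composition (`mem_coboundaries_two`). The remaining components of the cocycle
equation impose linear relations that force this (`exists_scalar`), except when $n=2$, $g$ is scalar
and the characteristic is 2. -/

namespace Hochschild

/-! ### Graded bimodules, their Hochschild complex, and split exact sequences. -/

section Bimodule

variable {k A M M' M'' : Type*} [CommRing k] [Ring A] [Algebra k A]
  [AddCommGroup M] [Module k M] [AddCommGroup M'] [Module k M'] [AddCommGroup M''] [Module k M'']

/-- The structure of a graded (not necessarily unital) bimodule over the graded algebra
`A = ⨁ 𝒜 d` on a `k`-module `M`. -/
structure GradedBimodule (𝒜 : ℤ → Submodule k A) (M : Type*) [AddCommGroup M] [Module k M] where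
  /-- the left action `m ↦ a m` -/
  left : A →ₗ[k] M →ₗ[k] M
  /-- the right action `m ↦ m a` -/
  right : A →ₗ[k] M →ₗ[k] M
  left_mul : ∀ a b m, left (a * b) m = left a (left b m)
  right_mul : ∀ a b m, right (a * b) m = right b (right a m)
  left_right : ∀ a b m, left a (right b m) = right b (left a m)
  /-- the homogeneous pieces -/
  gr : ℤ → Submodule k M
  left_mem : ∀ {d e a m}, a ∈ 𝒜 d → m ∈ gr e → left a m ∈ gr (d + e)
  right_mem : ∀ {d e a m}, a ∈ 𝒜 d → m ∈ gr e → right a m ∈ gr (e + d)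

/-- All `k`-linear maps `A^{⊗ s} → M`. -/
abbrev BimoduleCochain (k A M : Type*) [CommRing k] [Ring A] [Algebra k A] [AddCommGroup M]
    [Module k M] (s : ℕ) :=
  MultilinearMap k (fun _ : Fin s => A) M

namespace GradedBimodule

variable {𝒜 : ℤ → Submodule k A}

/-- `(a₀, …, a_s) ↦ a₀ f(a₁, …, a_s)`. -/
def firstFace (B : GradedBimodule 𝒜 M) {s : ℕ} (f : BimoduleCochain k A M s) :
    BimoduleCochain k A M (s + 1) :=
  LinearMap.uncurryLeft (R := k) (M := fun _ : Fin (s + 1) => A)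
    { toFun := fun a => (B.left a).compMultilinearMap f
      map_add' := fun a b => by ext; simp
      map_smul' := fun r a => by ext; simp }

/-- `(a₀, …, a_s) ↦ f(a₀, …, a_i a_{i+1}, …, a_s)`. -/
def innerFace {s : ℕ} (i : Fin s) (f : BimoduleCochain k A M s) : BimoduleCochain k A M (s + 1) :=
  MultilinearMap.mk' (fun a => f (i.castSucc.contractNth (· * ·) a))
    (fun a j x y => by
      obtain ⟨p, L, h⟩ := contractNth_update (k := k) i a j
      simp [h])
    (fun a j c x => by
      obtain ⟨p, L, h⟩ := contractNth_update (k := k) i a j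
      simp [h])

/-- `(a₀, …, a_s) ↦ f(a₀, …, a_{s-1}) a_s`. -/
def lastFace (B : GradedBimodule 𝒜 M) {s : ℕ} (f : BimoduleCochain k A M s) :
    BimoduleCochain k A M (s + 1) :=
  MultilinearMap.uncurryRight (R := k) (M := fun _ : Fin (s + 1) => A)
    (B.right.flip.compMultilinearMap f)

lemma firstFace_apply (B : GradedBimodule 𝒜 M) {s : ℕ} (f : BimoduleCochain k A M s)
    (a : Fin (s + 1) → A) : B.firstFace f a = B.left (a 0) (f fun i => a i.succ) := rfl

lemma innerFace_apply {s : ℕ} (i : Fin s) (f : BimoduleCochain k A M s) (a : Fin (s + 1) → A) :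
    innerFace i f a = f (i.castSucc.contractNth (· * ·) a) := rfl

lemma lastFace_apply (B : GradedBimodule 𝒜 M) {s : ℕ} (f : BimoduleCochain k A M s)
    (a : Fin (s + 1) → A) :
    B.lastFace f a = B.right (a (Fin.last s)) (f fun i => a i.castSucc) := rfl

/-- The Hochschild differential with coefficients in a bimodule. -/
def d (B : GradedBimodule 𝒜 M) (s : ℕ) :
    BimoduleCochain k A M s →ₗ[k] BimoduleCochain k A M (s + 1) where
  toFun f := B.firstFace f + ∑ i : Fin s, (-1 : ℤ) ^ ((i : ℕ) + 1) • innerFace i f +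
    (-1 : ℤ) ^ (s + 1) • B.lastFace f
  map_add' f f' := by
    ext a
    simp only [add_apply, sum_apply, smul_apply, map_add,
      firstFace_apply, innerFace_apply, lastFace_apply, smul_add, Finset.sum_add_distrib]
    abel
  map_smul' c f := by
    ext a
    simp only [add_apply, sum_apply, smul_apply, map_smul,
      firstFace_apply, innerFace_apply, lastFace_apply, RingHom.id_apply, smul_add,
      Finset.smul_sum, smul_comm c]

lemma d_apply (B : GradedBimodule 𝒜 M) {s : ℕ} (f : BimoduleCochain k A M s)
    (a : Fin (s + 1) → A) :
    B.d s f a = B.left (a 0) (f fun i => a i.succ) +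
      ∑ i : Fin s, (-1 : ℤ) ^ ((i : ℕ) + 1) • f (i.castSucc.contractNth (· * ·) a) +
      (-1 : ℤ) ^ (s + 1) • B.right (a (Fin.last s)) (f fun i => a i.castSucc) := by
  simp only [d, LinearMap.coe_mk, AddHom.coe_mk, add_apply, sum_apply,
    smul_apply, firstFace_apply, innerFace_apply, lastFace_apply]

/-- All faces, numbered from `0` to `s + 1`. -/
def face (B : GradedBimodule 𝒜 M) {s : ℕ} (i : Fin (s + 2))
    (f : BimoduleCochain k A M s) : BimoduleCochain k A M (s + 1) :=
  Fin.cases (B.firstFace f) (Fin.lastCases (B.lastFace f) (fun j => innerFace j f)) i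

lemma face_zero (B : GradedBimodule 𝒜 M) {s : ℕ} (f : BimoduleCochain k A M s) :
    B.face 0 f = B.firstFace f := rfl

lemma face_inner (B : GradedBimodule 𝒜 M) {s : ℕ} (f : BimoduleCochain k A M s)
    (i : Fin s) : B.face i.castSucc.succ f = innerFace i f := by
  simp only [face, Fin.cases_succ, Fin.lastCases_castSucc]

lemma face_last (B : GradedBimodule 𝒜 M) {s : ℕ} (f : BimoduleCochain k A M s) :
    B.face (Fin.last s).succ f = B.lastFace f := by
  simp only [face, Fin.cases_succ, Fin.lastCases_last]

lemma d_eq (B : GradedBimodule 𝒜 M) {s : ℕ} (f : BimoduleCochain k A M s) :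
    B.d s f = ∑ i : Fin (s + 2), (-1 : ℤ) ^ (i : ℕ) • B.face i f := by
  rw [Fin.sum_univ_succ, Fin.sum_univ_castSucc]
  simp only [face_zero, face_inner, face_last, d]
  simp [add_assoc]

lemma face_face (B : GradedBimodule 𝒜 M) {s : ℕ}
    (f : BimoduleCochain k A M s) (i j : Fin (s + 2)) (h : i ≤ j) :
    B.face j.succ (B.face i f) = B.face i.castSucc (B.face j f) := by
  ext a
  induction i using Fin.cases with
  | zero =>
    rw [Fin.castSucc_zero, face_zero, face_zero, firstFace_apply]
    induction j using Fin.cases with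
    | zero =>
      have : (0 : Fin (s + 2)).succ = (0 : Fin (s + 1)).castSucc.succ := rfl
      rw [this, face_inner, face_zero, innerFace_apply, firstFace_apply, firstFace_apply,
        ← B.left_mul]
      rfl
    | succ j =>
      induction j using Fin.lastCases with
      | last =>
        rw [show (Fin.last s).succ.succ = (Fin.last (s + 1)).succ from rfl, face_last, face_last,
          lastFace_apply, lastFace_apply, firstFace_apply, B.left_right]
        rfl
      | cast q =>
        rw [show q.castSucc.succ.succ = q.succ.castSucc.succ from rfl, face_inner, face_inner,
          innerFace_apply, innerFace_apply, firstFace_apply]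
        congr 1
        congr 1
        funext r
        simp [Fin.contractNth]
  | succ i =>
    induction j using Fin.cases with
    | zero => simp at h
    | succ j =>
      have h' := Fin.succ_le_succ_iff.1 h
      induction j using Fin.lastCases with
      | last =>
        rw [face_last, show (Fin.last s).succ.succ = (Fin.last (s + 1)).succ from rfl, face_last,
          lastFace_apply]
        induction i using Fin.lastCases with
        | last =>
          rw [face_last, show (Fin.last s).succ.castSucc = (Fin.last s).castSucc.succ from rfl,
            face_inner, innerFace_apply, lastFace_apply, lastFace_apply, ← B.right_mul]
          congr 1
          · congr 1
            simp [Fin.contractNth]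
          · congr 1
            funext r
            simp [Fin.contractNth]
        | cast p =>
          rw [face_inner, show p.castSucc.succ.castSucc = p.castSucc.castSucc.succ from rfl,
            face_inner, innerFace_apply, innerFace_apply, lastFace_apply]
          congr 2
          simp only [Fin.contractNth, Fin.val_castSucc, Fin.val_last]
          have := p.2
          split_ifs <;> first | lia | rfl
      | cast q =>
        induction i using Fin.lastCases with
        | last =>
          have := Fin.le_def.1 h'
          simp at this
          have := q.2
          lia
        | cast p =>
          rw [show q.castSucc.succ.succ = q.succ.castSucc.succ from rfl, face_inner, face_inner,
            show p.castSucc.succ.castSucc = p.castSucc.castSucc.succ from rfl, face_inner,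
            face_inner]
          simp only [innerFace_apply]
          rw [contractNth_contractNth p q h']

theorem d_d (B : GradedBimodule 𝒜 M) {s : ℕ} (f : BimoduleCochain k A M s) :
    B.d (s + 1) (B.d s f) = 0 := by
  have hf (j : Fin (s + 3)) : B.face j (B.d s f) =
      ∑ i : Fin (s + 2), (-1 : ℤ) ^ (i : ℕ) • B.face j (B.face i f) := by
    rw [d_eq]
    ext a
    induction j using Fin.cases with
    | zero => simp only [face_zero, firstFace_apply, sum_apply, smul_apply, map_sum, map_zsmul]
    | succ j =>
      induction j using Fin.lastCases with
      | last => simp only [face_last, lastFace_apply, sum_apply, smul_apply, map_sum, map_zsmul]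
      | cast q => simp only [face_inner, innerFace_apply, sum_apply, smul_apply]
  rw [d_eq]
  simp only [hf, Finset.smul_sum, smul_smul]
  rw [← Finset.sum_product', Finset.univ_product_univ]
  let P := Fin (s + 3) × Fin (s + 2)
  -- In a pair the first entry is the outer face. By `face_face` the pair $(p,q)$ with $p\le q$
  -- cancels against $(q+1,p)$, whose sign is opposite.
  let S : Finset P := {x : P | (x.1 : ℕ) ≤ (x.2 : ℕ)}
  rw [← Finset.sum_add_sum_compl S, ← eq_neg_iff_add_eq_zero, ← Finset.sum_neg_distrib]
  refine Finset.sum_bij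
    (fun x hx => (x.2.succ, x.1.castLT (lt_of_le_of_lt (Finset.mem_filter.mp hx).2 x.2.2)))
    ?_ ?_ ?_ ?_
  · intro x hx
    simp only [S, Finset.mem_filter_univ, Finset.mem_compl, Fin.val_succ, Fin.val_castLT] at hx ⊢
    lia
  · rintro ⟨i, j⟩ hx ⟨i', j'⟩ hx' h
    have h1 := congrArg (fun x => (x.1 : ℕ)) h
    have h2 := congrArg (fun x => (x.2 : ℕ)) h
    simp only [Fin.val_succ, Fin.val_castLT] at h1 h2
    exact Prod.ext (Fin.ext h2) (Fin.ext (by lia))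
  · rintro ⟨i, j⟩ hx
    simp only [S, Finset.mem_filter_univ, Finset.mem_compl, not_le] at hx
    have := i.2
    refine ⟨(j.castSucc, ⟨i - 1, by lia⟩), ?_, ?_⟩
    · simp only [S, Finset.mem_filter_univ, Fin.val_castSucc]
      lia
    · refine Prod.ext (Fin.ext ?_) rfl
      simp only [Fin.val_succ]
      lia
  · rintro ⟨i, j⟩ hx
    simp only [S, Finset.mem_filter_univ] at hx
    have := B.face_face f (i.castLT (lt_of_le_of_lt hx j.2)) j hx
    simp only [this, Fin.castSucc_castLT, Fin.val_succ, Fin.val_castLT, ← neg_smul]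
    congr 1
    ring

/-- The cochains of internal degree `0`. -/
def homogeneous (B : GradedBimodule 𝒜 M) (s : ℕ) : Submodule k (BimoduleCochain k A M s) where
  carrier := {f | ∀ (e : Fin s → ℤ) (a : Fin s → A), (∀ i, a i ∈ 𝒜 (e i)) →
    f a ∈ B.gr (∑ i, e i)}
  zero_mem' _ _ _ := zero_mem _
  add_mem' hf hf' e a h := add_mem (hf e a h) (hf' e a h)
  smul_mem' c _ hf e a h := Submodule.smul_mem _ c (hf e a h)

lemma d_mem [GradedAlgebra 𝒜] (B : GradedBimodule 𝒜 M) {s : ℕ} {f : BimoduleCochain k A M s}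
    (hf : f ∈ B.homogeneous s) : B.d s f ∈ B.homogeneous (s + 1) := by
  rw [d_eq]
  refine Submodule.sum_mem _ fun i _ => zsmul_mem ?_ _
  intro e a h
  induction i using Fin.cases with
  | zero =>
    rw [face_zero, firstFace_apply, Fin.sum_univ_succ]
    exact B.left_mem (h 0) (hf (fun i => e i.succ) _ fun i => h i.succ)
  | succ i =>
    induction i using Fin.lastCases with
    | last =>
      rw [face_last, lastFace_apply, Fin.sum_univ_castSucc]
      exact B.right_mem (h _) (hf (fun i => e i.castSucc) _ fun i => h i.castSucc)
    | cast p =>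
      rw [face_inner, innerFace_apply, ← sum_contractNth p e]
      refine hf _ _ fun q => ?_
      simp only [Fin.contractNth]
      split_ifs
      · exact h _
      · exact SetLike.mul_mem_graded (h _) (h _)
      · exact h _

/-- Coboundaries of homogeneous cochains; zero for `s = 0`. -/
def coboundaries (B : GradedBimodule 𝒜 M) : (s : ℕ) → Submodule k (BimoduleCochain k A M s)
  | 0 => ⊥
  | s + 1 => (B.homogeneous s).map (B.d s)

/-- The homogeneous Hochschild complex with coefficients in `B` is exact at the cochains with
`s` arguments. -/
def Acyclic (B : GradedBimodule 𝒜 M) (s : ℕ) : Prop :=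
  ∀ f ∈ B.homogeneous s, B.d s f = 0 → f ∈ B.coboundaries s

lemma comp_mem_homogeneous {B : GradedBimodule 𝒜 M} {B' : GradedBimodule 𝒜 M'} {L : M →ₗ[k] M'}
    (hL : ∀ e, ∀ m ∈ B.gr e, L m ∈ B'.gr e) {s : ℕ} {f : BimoduleCochain k A M s}
    (hf : f ∈ B.homogeneous s) : L.compMultilinearMap f ∈ B'.homogeneous s :=
  fun e a h => hL _ _ (hf e a h)

/-- A linear map which is compatible with the actions on a submodule `W` commutes with the
differential on cochains with values in `W`. -/
lemma d_comp_of_mem {B : GradedBimodule 𝒜 M} {B' : GradedBimodule 𝒜 M'} (L : M →ₗ[k] M')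
    (W : Submodule k M) (hl : ∀ a, ∀ m ∈ W, L (B.left a m) = B'.left a (L m))
    (hr : ∀ a, ∀ m ∈ W, L (B.right a m) = B'.right a (L m)) {s : ℕ}
    {f : BimoduleCochain k A M s} (hf : ∀ a, f a ∈ W) :
    B'.d s (L.compMultilinearMap f) = L.compMultilinearMap (B.d s f) := by
  ext a
  simp only [d_apply, LinearMap.compMultilinearMap_apply, map_add, map_sum, map_zsmul,
    hl _ _ (hf _), hr _ _ (hf _)]

lemma d_comp {B : GradedBimodule 𝒜 M} {B' : GradedBimodule 𝒜 M'} (L : M →ₗ[k] M')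
    (hl : ∀ a m, L (B.left a m) = B'.left a (L m))
    (hr : ∀ a m, L (B.right a m) = B'.right a (L m)) {s : ℕ} (f : BimoduleCochain k A M s) :
    B'.d s (L.compMultilinearMap f) = L.compMultilinearMap (B.d s f) :=
  d_comp_of_mem L ⊤ (fun a m _ => hl a m) (fun a m _ => hr a m) (fun _ => trivial)

/-- If the component `q ∘ f` of a cocycle `f` with values in the subbimodule `W` is a coboundary,
then `f` can be corrected by a coboundary so that it takes values in `W ⊓ ker q`. -/
lemma exists_sub_mem_ker (B : GradedBimodule 𝒜 M) (B'' : GradedBimodule 𝒜 M'')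
    (W : Submodule k M) (hWl : ∀ a, ∀ m ∈ W, B.left a m ∈ W)
    (hWr : ∀ a, ∀ m ∈ W, B.right a m ∈ W) (q : M →ₗ[k] M'') (σ : M'' →ₗ[k] M)
    (hσW : ∀ m, σ m ∈ W) (hσ : ∀ e, ∀ m ∈ B''.gr e, σ m ∈ B.gr e) (hqσ : ∀ m, q (σ m) = m)
    (hl : ∀ a, ∀ m ∈ W, q (B.left a m) = B''.left a (q m))
    (hr : ∀ a, ∀ m ∈ W, q (B.right a m) = B''.right a (q m)) {s : ℕ}
    {f : BimoduleCochain k A M s} (hfW : ∀ a, f a ∈ W)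
    (hqf : q.compMultilinearMap f ∈ B''.coboundaries s) :
    ∃ h ∈ B.coboundaries s, ∀ a, (f - h) a ∈ W ⊓ LinearMap.ker q := by
  cases s with
  | zero =>
    -- Without arguments there are no nonzero coboundaries, so $q\circ f$ already vanishes and no
    -- correction is needed.
    refine ⟨0, zero_mem _, fun a => ⟨by simpa using hfW a, ?_⟩⟩
    have h := congrArg (fun f => f a) ((Submodule.mem_bot k).1 hqf)
    simpa using h
  | succ s =>
    obtain ⟨u, hu, hqu⟩ := hqf
    -- The section $\sigma$ need not respect the actions. It only has to land in $W$, where $q$ does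
    -- respect them, so that $q\circ d(\sigma\circ u)=du$.
    refine ⟨B.d s (σ.compMultilinearMap u), ⟨_, comp_mem_homogeneous hσ hu, rfl⟩, fun a => ?_⟩
    have hW (a) : B.d s (σ.compMultilinearMap u) a ∈ W := by
      rw [d_apply]
      refine add_mem (add_mem (hWl _ _ (hσW _)) (sum_mem fun i _ => zsmul_mem (hσW _) _))
        (zsmul_mem (hWr _ _ (hσW _)) _)
    refine ⟨sub_mem (hfW a) (hW a), ?_⟩
    have h1 := d_comp_of_mem (B := B) (B' := B'') q W hl hr (f := σ.compMultilinearMap u)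
      (fun a => hσW _)
    have h2 : q.compMultilinearMap (σ.compMultilinearMap u) = u := by
      ext a
      simp [hqσ]
    rw [h2, hqu] at h1
    have h3 := congrArg (fun f => f a) h1
    simp only [LinearMap.compMultilinearMap_apply] at h3
    simp [h3]

lemma coboundaries_le_ker (B : GradedBimodule 𝒜 M) {s : ℕ} {h : BimoduleCochain k A M s}
    (hh : h ∈ B.coboundaries s) : B.d s h = 0 := by
  cases s with
  | zero => simp [(Submodule.mem_bot k).1 hh]
  | succ s =>
    obtain ⟨u, -, rfl⟩ := hh
    exact B.d_d u

lemma coboundaries_le_homogeneous [GradedAlgebra 𝒜] (B : GradedBimodule 𝒜 M) (s : ℕ) :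
    B.coboundaries s ≤ B.homogeneous s := by
  cases s with
  | zero => exact bot_le
  | succ s =>
    rintro _ ⟨u, hu, rfl⟩
    exact B.d_mem hu

/-- The data of a short exact sequence `0 → M' → M → M'' → 0` of graded bimodules, split as a
sequence of graded `k`-modules. -/
structure SplitExact (B' : GradedBimodule 𝒜 M') (B : GradedBimodule 𝒜 M)
    (B'' : GradedBimodule 𝒜 M'') where
  /-- the inclusion -/
  i : M' →ₗ[k] M
  /-- the retraction onto `M'` -/
  p : M →ₗ[k] M'
  /-- the projection -/
  q : M →ₗ[k] M''
  /-- the section of the projection -/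
  σ : M'' →ₗ[k] M
  i_left : ∀ a m, i (B'.left a m) = B.left a (i m)
  i_right : ∀ a m, i (B'.right a m) = B.right a (i m)
  q_left : ∀ a m, q (B.left a m) = B''.left a (q m)
  q_right : ∀ a m, q (B.right a m) = B''.right a (q m)
  i_mem : ∀ e, ∀ m ∈ B'.gr e, i m ∈ B.gr e
  p_mem : ∀ e, ∀ m ∈ B.gr e, p m ∈ B'.gr e
  q_mem : ∀ e, ∀ m ∈ B.gr e, q m ∈ B''.gr e
  σ_mem : ∀ e, ∀ m ∈ B''.gr e, σ m ∈ B.gr e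
  p_i : ∀ m, p (i m) = m
  q_i : ∀ m, q (i m) = 0
  q_σ : ∀ m, q (σ m) = m
  i_p_add : ∀ m, i (p m) + σ (q m) = m

namespace SplitExact

variable {B' : GradedBimodule 𝒜 M'} {B : GradedBimodule 𝒜 M} {B'' : GradedBimodule 𝒜 M''}

lemma i_comp_injective (E : SplitExact B' B B'') {s : ℕ} {f f' : BimoduleCochain k A M' s}
    (h : E.i.compMultilinearMap f = E.i.compMultilinearMap f') : f = f' := by
  ext a
  have := congrArg (fun f => E.p (f a)) h
  simpa [E.p_i] using this

lemma i_comp_p_comp (E : SplitExact B' B B'') {s : ℕ} {f : BimoduleCochain k A M s}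
    (h : ∀ a, E.q (f a) = 0) : E.i.compMultilinearMap (E.p.compMultilinearMap f) = f := by
  ext a
  have := E.i_p_add (f a)
  rwa [h, map_zero, add_zero] at this

/-- Exactness of the long exact sequence at the middle term: correct a cocycle until its image in
$M''$ is zero, then solve in $M'$. -/
theorem acyclic_middle [GradedAlgebra 𝒜] (E : SplitExact B' B B'') {s : ℕ} (h' : B'.Acyclic s)
    (h'' : B''.Acyclic s) : B.Acyclic s := by
  intro f hf hdf
  have hq : E.q.compMultilinearMap f ∈ B''.coboundaries s := by
    refine h'' _ (comp_mem_homogeneous E.q_mem hf) ?_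
    rw [d_comp E.q E.q_left E.q_right, hdf]
    ext
    simp
  obtain ⟨u, hu, huq⟩ := exists_sub_mem_ker B B'' ⊤ (fun _ _ _ => trivial) (fun _ _ _ => trivial)
    E.q E.σ (fun _ => trivial) E.σ_mem E.q_σ (fun a m _ => E.q_left a m)
    (fun a m _ => E.q_right a m) (fun _ => trivial) hq
  have hfu : f - u ∈ B.homogeneous s := sub_mem hf (B.coboundaries_le_homogeneous s hu)
  have hip := E.i_comp_p_comp (f := f - u) fun a => (huq a).2
  have hp : E.p.compMultilinearMap (f - u) ∈ B'.coboundaries s := by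
    refine h' _ (comp_mem_homogeneous E.p_mem hfu) (E.i_comp_injective ?_)
    rw [← d_comp E.i E.i_left E.i_right, hip, map_sub, hdf, B.coboundaries_le_ker hu]
    ext
    simp
  have hmem : f - u ∈ B.coboundaries s := by
    rw [← hip]
    cases s with
    | zero =>
      rw [(Submodule.mem_bot k).1 hp]
      refine (Submodule.mem_bot k).2 ?_
      ext
      simp
    | succ s =>
      obtain ⟨v, hv, hpv⟩ := hp
      refine ⟨E.i.compMultilinearMap v, comp_mem_homogeneous E.i_mem hv, ?_⟩
      rw [d_comp E.i E.i_left E.i_right, hpv]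
  simpa using add_mem hmem hu

/-- The dimension shift: when the middle term is acyclic in degree $s+1$, cohomology of $M'$ there
comes from $M''$ in degree $s$ through the connecting map. -/
theorem acyclic_left_succ [GradedAlgebra 𝒜] (E : SplitExact B' B B'') {s : ℕ}
    (h : B.Acyclic (s + 1)) (h'' : B''.Acyclic s) : B'.Acyclic (s + 1) := by
  intro f hf hdf
  obtain ⟨u, hu, hdu⟩ := h (E.i.compMultilinearMap f) (comp_mem_homogeneous E.i_mem hf) (by
    rw [d_comp E.i E.i_left E.i_right, hdf]
    ext
    simp)
  have hq : E.q.compMultilinearMap u ∈ B''.coboundaries s := by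
    refine h'' _ (comp_mem_homogeneous E.q_mem hu) ?_
    rw [d_comp E.q E.q_left E.q_right, hdu]
    ext
    simp [E.q_i]
  -- The primitive $u$ of $i\circ f$ is determined up to cocycles; changing it by a coboundary
  -- brings its values into $\ker q$, which is the image of $i$.
  obtain ⟨v, hv, hvq⟩ := exists_sub_mem_ker B B'' ⊤ (fun _ _ _ => trivial) (fun _ _ _ => trivial)
    E.q E.σ (fun _ => trivial) E.σ_mem E.q_σ (fun a m _ => E.q_left a m)
    (fun a m _ => E.q_right a m) (fun _ => trivial) hq
  have huv : u - v ∈ B.homogeneous s := sub_mem hu (B.coboundaries_le_homogeneous s hv)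
  refine ⟨E.p.compMultilinearMap (u - v), comp_mem_homogeneous E.p_mem huv,
    E.i_comp_injective ?_⟩
  rw [← d_comp E.i E.i_left E.i_right, E.i_comp_p_comp fun a => (hvq a).2, map_sub, hdu,
    B.coboundaries_le_ker hv, sub_zero]

end SplitExact

end GradedBimodule

end Bimodule

end Hochschild

namespace Hochschild

/-! ### Simple bimodules, duals of left modules, and acyclicity of duals of projectives. -/

section LeftModule

variable {k A N U : Type*} [CommRing k] [Ring A] [Algebra k A]
  [AddCommGroup N] [Module k N] [AddCommGroup U] [Module k U]

/-- A character of the graded algebra `A = ⨁ 𝒜 d` which vanishes outside degree `0`. -/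
structure GradedCharacter (𝒜 : ℤ → Submodule k A) extends A →ₗ[k] k where
  map_mul : ∀ a b, toFun (a * b) = toFun a * toFun b
  eq_zero : ∀ {d a}, a ∈ 𝒜 d → d ≠ 0 → toFun a = 0

/-- The structure of a graded left module over the graded algebra `A = ⨁ 𝒜 d`. -/
structure GradedLeftModule (𝒜 : ℤ → Submodule k A) (N : Type*) [AddCommGroup N] [Module k N] where
  /-- the action -/
  act : A →ₗ[k] N →ₗ[k] N
  act_mul : ∀ a b n, act (a * b) n = act a (act b n)
  /-- the homogeneous pieces -/
  gr : ℤ → Submodule k N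
  act_mem : ∀ {d e a n}, a ∈ 𝒜 d → n ∈ gr e → act a n ∈ gr (d + e)

variable {𝒜 : ℤ → Submodule k A}

instance : CoeFun (GradedCharacter 𝒜) (fun _ => A → k) := ⟨fun χ => χ.toLinearMap⟩

lemma GradedCharacter.mul (χ : GradedCharacter 𝒜) (a b : A) : χ (a * b) = χ a * χ b :=
  χ.map_mul a b

lemma GradedCharacter.apply_eq_zero (χ : GradedCharacter 𝒜) {d : ℤ} {a : A} (ha : a ∈ 𝒜 d)
    (hd : d ≠ 0) : χ a = 0 :=
  χ.eq_zero ha hd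

namespace GradedBimodule

/-- The bimodule on which `A` acts from the left by the character `χ` and from the right by the
character `ψ`, concentrated in degree `d`. -/
def ofCharacters (χ ψ : GradedCharacter 𝒜) (d : ℤ) (U : Type*) [AddCommGroup U] [Module k U] :
    GradedBimodule 𝒜 U where
  left := χ.toLinearMap.smulRight LinearMap.id
  right := ψ.toLinearMap.smulRight LinearMap.id
  left_mul a b m := by simpa [χ.mul, mul_smul] using smul_comm _ _ _
  right_mul a b m := by simp [ψ.mul, mul_smul, smul_comm (ψ a)]
  left_right a b m := by simp [smul_comm (χ a)]
  gr e :=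
    { carrier := {u | e ≠ d → u = 0}
      zero_mem' := fun _ => rfl
      add_mem' := fun ha hb h => by rw [ha h, hb h, add_zero]
      smul_mem' := fun c _ ha h => by rw [ha h, smul_zero] }
  left_mem {m e a u} ha hu h := by
    by_cases hm : m = 0
    · subst hm
      rw [hu (by simpa using h), map_zero]
    · simp [χ.apply_eq_zero ha hm]
  right_mem {m e a u} ha hu h := by
    by_cases hm : m = 0
    · subst hm
      rw [hu (by simpa using h), map_zero]
    · simp [ψ.apply_eq_zero ha hm]

@[simp] lemma ofCharacters_left (χ ψ : GradedCharacter 𝒜) (d : ℤ) (a : A) (u : U) :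
    (ofCharacters χ ψ d U).left a u = χ a • u := rfl

@[simp] lemma ofCharacters_right (χ ψ : GradedCharacter 𝒜) (d : ℤ) (a : A) (u : U) :
    (ofCharacters χ ψ d U).right a u = ψ a • u := rfl

lemma mem_ofCharacters_gr {χ ψ : GradedCharacter 𝒜} {d e : ℤ} {u : U} :
    u ∈ (ofCharacters χ ψ d U).gr e ↔ (e ≠ d → u = 0) := Iff.rfl

/-- Acyclicity for a one-dimensional space of coefficients implies it for free coefficients of
finite rank with the same actions. -/
lemma acyclic_ofCharacters_of_basis {ι : Type*} [Fintype ι] (b : Module.Basis ι k U)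
    {χ ψ : GradedCharacter 𝒜} {d : ℤ} {s : ℕ} (h : (ofCharacters χ ψ d k).Acyclic s) :
    (ofCharacters χ ψ d U).Acyclic s := by
  intro f hf hdf
  have hc (i : ι) : (b.coord i).compMultilinearMap f ∈ (ofCharacters χ ψ d k).coboundaries s := by
    refine h _ (comp_mem_homogeneous (B := ofCharacters χ ψ d U) (B' := ofCharacters χ ψ d k)
      (fun e m hm => mem_ofCharacters_gr.2 fun hed => by simp [hm hed]) hf) ?_
    rw [d_comp (B := ofCharacters χ ψ d U) (B' := ofCharacters χ ψ d k) (b.coord i)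
      (fun a m => by simp) (fun a m => by simp), hdf]
    ext
    simp
  have hsum : f = ∑ i, (LinearMap.toSpanSingleton k U (b i)).compMultilinearMap
      ((b.coord i).compMultilinearMap f) := by
    ext a
    simp [b.sum_repr]
  rw [hsum]
  refine sum_mem fun i _ => ?_
  cases s with
  | zero =>
    rw [(Submodule.mem_bot k).1 (hc i)]
    refine (Submodule.mem_bot k).2 ?_
    ext
    simp
  | succ s =>
    obtain ⟨u, hu, hdu⟩ := hc i
    refine ⟨(LinearMap.toSpanSingleton k U (b i)).compMultilinearMap u,
      comp_mem_homogeneous (B := ofCharacters χ ψ d k) (B' := ofCharacters χ ψ d U)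
        (fun e m hm => mem_ofCharacters_gr.2 fun hed => by simp [hm hed]) hu, ?_⟩
    rw [d_comp (B := ofCharacters χ ψ d k) (B' := ofCharacters χ ψ d U) _
      (fun a m => by simp [smul_smul, mul_comm])
      (fun a m => by simp [smul_smul, mul_comm]), hdu]

end GradedBimodule

namespace GradedLeftModule

/-- The dual `Hom(N, k)` of a left module, with `A` acting from the left by the character `χ`.
A functional has degree `e` if it is supported in degree `d - e`. -/
def dual (B : GradedLeftModule 𝒜 N) (χ : GradedCharacter 𝒜) (d : ℤ) :
    GradedBimodule 𝒜 (N →ₗ[k] k) where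
  left := χ.toLinearMap.smulRight LinearMap.id
  right := LinearMap.mk₂ k (fun a φ => φ ∘ₗ B.act a) (fun a b φ => by ext; simp)
    (fun c a φ => by ext; simp) (fun a φ ψ => by ext; simp) (fun c a φ => by ext; simp)
  left_mul a b m := by
    ext
    simp [χ.mul]
    ring
  right_mul a b m := by ext; simp [B.act_mul]
  left_right a b m := by ext; simp
  gr e :=
    { carrier := {φ | ∀ j, ∀ n ∈ B.gr j, e + j ≠ d → φ n = 0}
      zero_mem' := fun _ _ _ _ => rfl
      add_mem' := fun ha hb j n hn h => by simp [ha j n hn h, hb j n hn h]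
      smul_mem' := fun c _ ha j n hn h => by simp [ha j n hn h] }
  left_mem {m e a φ} ha hφ j n hn h := by
    by_cases hm : m = 0
    · subst hm
      have := hφ j n hn (by simpa using h)
      simp [this]
    · simp [χ.apply_eq_zero ha hm]
  right_mem {m e a φ} ha hφ j n hn h := by
    simpa using hφ (m + j) _ (B.act_mem ha hn) (by rwa [← add_assoc])

@[simp] lemma dual_left_apply (B : GradedLeftModule 𝒜 N) (χ : GradedCharacter 𝒜) (d : ℤ) (a : A)
    (φ : N →ₗ[k] k) (n : N) : (B.dual χ d).left a φ n = χ a * φ n := rfl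

@[simp] lemma dual_right_apply (B : GradedLeftModule 𝒜 N) (χ : GradedCharacter 𝒜) (d : ℤ) (a : A)
    (φ : N →ₗ[k] k) (n : N) : (B.dual χ d).right a φ n = φ (B.act a n) := rfl

lemma mem_dual_gr {B : GradedLeftModule 𝒜 N} {χ : GradedCharacter 𝒜} {d e : ℤ}
    {φ : N →ₗ[k] k} :
    φ ∈ (B.dual χ d).gr e ↔ ∀ j, ∀ n ∈ B.gr j, e + j ≠ d → φ n = 0 := Iff.rfl

lemma contractNth_snoc_castSucc {s : ℕ} (i : Fin s) (a : Fin (s + 1) → A) (x : A) :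
    i.castSucc.castSucc.contractNth (· * ·) (Fin.snoc a x : Fin (s + 2) → A) =
      (Fin.snoc (i.castSucc.contractNth (· * ·) a) x : Fin (s + 1) → A) := by
  have hi := i.2
  funext r
  induction r using Fin.lastCases with
  | last =>
    rw [Fin.snoc_last, Fin.contractNth_apply_of_gt _ _ _ _ (by simp)]
    exact Fin.snoc_last (α := fun _ => A) x a
  | cast r =>
    rw [Fin.snoc_castSucc]
    simp only [Fin.contractNth, Fin.val_castSucc]
    have h1 : (r.castSucc : Fin (s + 1)).succ = r.succ.castSucc := rfl
    rw [h1]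
    simp only [Fin.snoc_castSucc]

lemma contractNth_snoc_last {s : ℕ} (a : Fin (s + 1) → A) (x : A) :
    (Fin.last s).castSucc.contractNth (· * ·) (Fin.snoc a x : Fin (s + 2) → A) =
      (Fin.snoc (fun i => a i.castSucc) (a (Fin.last s) * x) : Fin (s + 1) → A) := by
  funext r
  induction r using Fin.lastCases with
  | last =>
    rw [Fin.snoc_last, Fin.contractNth_apply_of_eq _ _ _ _ (by simp)]
    congr 1
    · exact Fin.snoc_castSucc (α := fun _ => A) x a (Fin.last s)
    · exact Fin.snoc_last (α := fun _ => A) x a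
  | cast r =>
    rw [Fin.snoc_castSucc, Fin.contractNth_apply_of_lt _ _ _ _ (by simp)]
    exact Fin.snoc_castSucc (α := fun _ => A) x a r.castSucc

/-- The dual of a direct summand of `A` is acyclic in positive degrees. -/
theorem acyclic_dual_succ (B : GradedLeftModule 𝒜 N) (χ : GradedCharacter 𝒜) (d : ℤ) (x : N)
    (j : N →ₗ[k] A) (hx : x ∈ B.gr 0) (hj : ∀ e, ∀ n ∈ B.gr e, j n ∈ 𝒜 e)
    (hmul : ∀ a n, j (B.act a n) = a * j n) (hjx : ∀ n, B.act (j n) x = n) (s : ℕ) :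
    (B.dual χ d).Acyclic (s + 1) := by
  intro f hf hdf
  -- The contracting homotopy: put $j(n)$ into the last slot of the cochain and evaluate the
  -- resulting functional at the generator $x$.
  let L : (A →ₗ[k] N →ₗ[k] k) →ₗ[k] N →ₗ[k] k :=
    LinearMap.mk₂ k (fun Ψ n => Ψ (j n) x) (fun _ _ _ => by simp) (fun _ _ _ => by simp)
      (fun _ _ _ => by simp) (fun _ _ _ => by simp)
  let h : BimoduleCochain k A (N →ₗ[k] k) s := L.compMultilinearMap f.curryRight
  have hh (a : Fin s → A) (n : N) : h a n = f (Fin.snoc a (j n)) x := rfl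
  have hhom : h ∈ (B.dual χ d).homogeneous s := by
    intro e a ha i n hn hne
    rw [hh]
    refine hf (Fin.snoc e i) _ (fun r => ?_) 0 x hx ?_
    · induction r using Fin.lastCases with
      | last => simpa using hj i n hn
      | cast r => simpa using ha r
    · rw [Fin.sum_univ_castSucc]
      simpa using hne
  refine ⟨(-1 : ℤ) ^ (s + 1) • h, zsmul_mem hhom _, ?_⟩
  ext a n
  -- In the cocycle equation at $(a,j(n))$ and $x$, the last face gives $f(a)(j(n)x)=f(a)(n)$. The
  -- last inner face uses $a_s\,j(n)=j(a_s n)$, which is the right action on $h$. Everything else is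
  -- $dh$.
  have key := congrArg (fun F => F (Fin.snoc a (j n)) x) hdf
  simp only [GradedBimodule.d_apply, Fin.sum_univ_castSucc, zero_apply,
    LinearMap.zero_apply, LinearMap.add_apply, LinearMap.smul_apply, LinearMap.sum_apply,
    contractNth_snoc_castSucc, contractNth_snoc_last, dual_left_apply, dual_right_apply,
    Fin.snoc_last, Fin.snoc_castSucc, Fin.val_castSucc, Fin.val_last, hjx] at key
  have h0 : (Fin.snoc a (j n) : Fin (s + 2) → A) 0 = a 0 := rfl
  have h1 : (fun i : Fin (s + 1) => (Fin.snoc a (j n) : Fin (s + 2) → A) i.succ) =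
      (Fin.snoc (fun i : Fin s => a i.succ) (j n) : Fin (s + 1) → A) := by
    funext r
    induction r using Fin.lastCases with
    | last => rw [Fin.succ_last, Fin.snoc_last, Fin.snoc_last]
    | cast r =>
      rw [Fin.snoc_castSucc, ← Fin.castSucc_succ, Fin.snoc_castSucc]
  rw [h0, h1] at key
  rw [map_zsmul]
  simp only [GradedBimodule.d_apply, smul_apply, LinearMap.smul_apply, LinearMap.add_apply,
    LinearMap.sum_apply, dual_left_apply, dual_right_apply, hh, hmul]
  have hsq : (-1 : ℤ) ^ (s + 1) * (-1 : ℤ) ^ (s + 1) = 1 := by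
    rw [← mul_pow]
    simp
  have hfin : ∀ X y : k, X + (-1 : ℤ) ^ (s + 1 + 1) • y = 0 → (-1 : ℤ) ^ (s + 1) • X = y := by
    intro X y hXy
    have hX : X = (-1 : ℤ) ^ (s + 1) • y := by
      rw [pow_succ _ (s + 1), mul_neg_one, neg_smul] at hXy
      exact (sub_eq_zero.1 (by rwa [← sub_eq_add_neg] at hXy))
    rw [hX, smul_smul, hsq, one_smul]
  refine hfin _ _ ?_
  rw [← key]
  abel

end GradedLeftModule

end LeftModule

end Hochschild

namespace Hochschild

/-! ### Two-vertex algebras and the one-sided linearity of their Ext groups. -/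

section TwoVertices

variable {k A V V' : Type*} [Field k] [Ring A] [Algebra k A] [AddCommGroup V] [Module k V]
  [AddCommGroup V'] [Module k V']

/-- A description of the graded algebra `A = ⨁ 𝒜 d` as the total morphism algebra of a category
with two objects `a` and `a'`, with `Hom(a, a') = V` in degree `δ`, `Hom(a', a) = V'` in degree
`δ'`, and the endomorphisms of `a` and `a'` spanned by the identity and one further element in
degree `δ + δ' = 1`, the compositions of `V` and `V'` being given by nondegenerate pairings. -/
structure TwoVertexAlgebra (𝒜 : ℤ → Submodule k A) (V V' : Type*) [AddCommGroup V] [Module k V]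
    [AddCommGroup V'] [Module k V'] where
  /-- coefficient of the identity of `a` -/
  ε : GradedCharacter 𝒜
  /-- coefficient of the identity of `a'` -/
  ε' : GradedCharacter 𝒜
  /-- component in `Hom(a, a')` -/
  w : A →ₗ[k] V
  /-- component in `Hom(a', a)` -/
  w' : A →ₗ[k] V'
  /-- coefficient of the nontrivial endomorphism of `a` -/
  z : A →ₗ[k] k
  /-- coefficient of the nontrivial endomorphism of `a'` -/
  z' : A →ₗ[k] k
  /-- the composition `Hom(a', a) × Hom(a, a') → End(a)` -/
  β : V' →ₗ[k] V →ₗ[k] k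
  /-- the composition `Hom(a, a') × Hom(a', a) → End(a')` -/
  β' : V →ₗ[k] V' →ₗ[k] k
  /-- the degree of `V` -/
  δ : ℤ
  /-- the degree of `V'` -/
  δ' : ℤ
  δ_add : δ + δ' = 1
  ext : ∀ {x y}, ε x = ε y → ε' x = ε' y → w x = w y → w' x = w' y → z x = z y → z' x = z' y →
    x = y
  w_mul : ∀ x y, w (x * y) = ε' x • w y + ε y • w x
  w'_mul : ∀ x y, w' (x * y) = ε x • w' y + ε' y • w' x
  z_mul : ∀ x y, z (x * y) = ε x * z y + z x * ε y + β (w' x) (w y)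
  z'_mul : ∀ x y, z' (x * y) = ε' x * z' y + z' x * ε' y + β' (w x) (w' y)
  mem_iff : ∀ {d x}, x ∈ 𝒜 d ↔ (d ≠ 0 → ε x = 0) ∧ (d ≠ 0 → ε' x = 0) ∧ (d ≠ δ → w x = 0) ∧
    (d ≠ δ' → w' x = 0) ∧ (d ≠ 1 → z x = 0) ∧ (d ≠ 1 → z' x = 0)
  /-- the elements of `A` which start at `a` -/
  ι : k × V × k →ₗ[k] A
  /-- the elements of `A` which start at `a'` -/
  ι' : k × V' × k →ₗ[k] A
  ι_spec : ∀ p, ε (ι p) = p.1 ∧ ε' (ι p) = 0 ∧ w (ι p) = p.2.1 ∧ w' (ι p) = 0 ∧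
    z (ι p) = p.2.2 ∧ z' (ι p) = 0
  ι'_spec : ∀ p, ε' (ι' p) = p.1 ∧ ε (ι' p) = 0 ∧ w' (ι' p) = p.2.1 ∧ w (ι' p) = 0 ∧
    z' (ι' p) = p.2.2 ∧ z (ι' p) = 0
  β_ne : ∀ v, v ≠ 0 → β.flip v ≠ 0
  β'_ne : ∀ v, v ≠ 0 → β'.flip v ≠ 0
  exists_mem_ker : ∀ θ : V →ₗ[k] k, ∃ v, v ≠ 0 ∧ θ v = 0
  exists_mem_ker' : ∀ θ : V' →ₗ[k] k, ∃ v, v ≠ 0 ∧ θ v = 0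

namespace TwoVertexAlgebra

variable {𝒜 : ℤ → Submodule k A}

/-- The projection onto the kernel of the functional `θ` along a vector `v₀` with `θ v₀ = 1`. -/
def kerProj (θ : V →ₗ[k] k) (v₀ : V) (hv₀ : θ v₀ = 1) : V →ₗ[k] LinearMap.ker θ :=
  (LinearMap.id - LinearMap.toSpanSingleton k V v₀ ∘ₗ θ).codRestrict (LinearMap.ker θ)
    (fun v => by simp [hv₀])

@[simp] lemma coe_kerProj (θ : V →ₗ[k] k) (v₀ : V) (hv₀ : θ v₀ = 1) (v : V) :
    (kerProj θ v₀ hv₀ v : V) = v - θ v • v₀ := rfl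

@[simp] lemma kerProj_apply_coe (θ : V →ₗ[k] k) (v₀ : V) (hv₀ : θ v₀ = 1)
    (v : LinearMap.ker θ) : kerProj θ v₀ hv₀ v = v := by
  ext
  simp [LinearMap.mem_ker.1 v.2]

@[simp] lemma kerProj_self (θ : V →ₗ[k] k) (v₀ : V) (hv₀ : θ v₀ = 1) :
    kerProj θ v₀ hv₀ v₀ = 0 := by
  ext
  simp [hv₀]

/-- Exchange of the two objects. -/
def swap (D : TwoVertexAlgebra 𝒜 V V') : TwoVertexAlgebra 𝒜 V' V where
  ε := D.ε'
  ε' := D.ε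
  w := D.w'
  w' := D.w
  z := D.z'
  z' := D.z
  β := D.β'
  β' := D.β
  δ := D.δ'
  δ' := D.δ
  δ_add := by rw [add_comm, D.δ_add]
  ext h1 h2 h3 h4 h5 h6 := D.ext h2 h1 h4 h3 h6 h5
  w_mul := D.w'_mul
  w'_mul := D.w_mul
  z_mul := D.z'_mul
  z'_mul := D.z_mul
  mem_iff := by
    intro d x
    rw [D.mem_iff]
    tauto
  ι := D.ι'
  ι' := D.ι
  ι_spec := D.ι'_spec
  ι'_spec := D.ι_spec
  β_ne := D.β'_ne
  β'_ne := D.β_ne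
  exists_mem_ker := D.exists_mem_ker'
  exists_mem_ker' := D.exists_mem_ker

variable (D : TwoVertexAlgebra 𝒜 V V')

/-- The submodule of elements of `k × V × k` supported in the given degrees. -/
def tripleGr (V : Type*) [AddCommGroup V] [Module k V] (δ : ℤ) (e : ℤ) :
    Submodule k (k × V × k) where
  carrier := {p | (e ≠ 0 → p.1 = 0) ∧ (e ≠ δ → p.2.1 = 0) ∧ (e ≠ 1 → p.2.2 = 0)}
  zero_mem' := by simp
  add_mem' := by
    rintro a b ⟨h1, h2, h3⟩ ⟨h1', h2', h3'⟩
    exact ⟨fun h => by simp [h1 h, h1' h], fun h => by simp [h2 h, h2' h],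
      fun h => by simp [h3 h, h3' h]⟩
  smul_mem' := by
    rintro c a ⟨h1, h2, h3⟩
    exact ⟨fun h => by simp [h1 h], fun h => by simp [h2 h], fun h => by simp [h3 h]⟩

/-- The submodule of elements of `U × k` supported in degrees `d₁` and `d₂`. -/
def pairGr (U : Type*) [AddCommGroup U] [Module k U] (d₁ d₂ : ℤ) (e : ℤ) :
    Submodule k (U × k) where
  carrier := {p | (e ≠ d₁ → p.1 = 0) ∧ (e ≠ d₂ → p.2 = 0)}
  zero_mem' := by simp
  add_mem' := by
    rintro a b ⟨h1, h2⟩ ⟨h1', h2'⟩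
    exact ⟨fun h => by simp [h1 h, h1' h], fun h => by simp [h2 h, h2' h]⟩
  smul_mem' := by
    rintro c a ⟨h1, h2⟩
    exact ⟨fun h => by simp [h1 h], fun h => by simp [h2 h]⟩

lemma w_eq_zero {d : ℤ} {x : A} (hx : x ∈ 𝒜 d) (hd : d ≠ D.δ) : D.w x = 0 :=
  (D.mem_iff.1 hx).2.2.1 hd

lemma w'_eq_zero {d : ℤ} {x : A} (hx : x ∈ 𝒜 d) (hd : d ≠ D.δ') : D.w' x = 0 :=
  (D.mem_iff.1 hx).2.2.2.1 hd

lemma z_eq_zero {d : ℤ} {x : A} (hx : x ∈ 𝒜 d) (hd : d ≠ 1) : D.z x = 0 :=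
  (D.mem_iff.1 hx).2.2.2.2.1 hd

/-- The module of morphisms which start at `a`. -/
def proj : GradedLeftModule 𝒜 (k × V × k) where
  act := LinearMap.mk₂ k
    (fun x p => (D.ε x * p.1, p.1 • D.w x + D.ε' x • p.2.1,
      D.z x * p.1 + D.ε x * p.2.2 + D.β (D.w' x) p.2.1))
    (fun x y p => by
      ext
      · simp; ring
      · simp; module
      · simp; ring)
    (fun c x p => by
      ext
      · simp; ring
      · simp; module
      · simp; ring)
    (fun x p p' => by
      ext
      · simp; ring
      · simp; module
      · simp; ring)
    (fun c x p => by
      ext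
      · simp; ring
      · simp; module
      · simp; ring)
  act_mul x y p := by
    ext
    · simp [D.ε.mul]; ring
    · simp [D.ε'.mul, D.w_mul]; module
    · simp [D.ε.mul, D.z_mul, D.w'_mul]; ring
  gr := tripleGr V D.δ
  act_mem := by
    rintro d e x ⟨p, v, q⟩ hx ⟨h1, h2, h3⟩
    have hδ := D.δ_add
    dsimp only at h1 h2 h3
    have e1 : d ≠ 0 → D.ε x = 0 := D.ε.apply_eq_zero hx
    have e2 : d ≠ 0 → D.ε' x = 0 := D.ε'.apply_eq_zero hx
    have e3 : d ≠ D.δ → D.w x = 0 := D.w_eq_zero hx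
    have e4 : d ≠ D.δ' → D.w' x = 0 := D.w'_eq_zero hx
    have e5 : d ≠ 1 → D.z x = 0 := D.z_eq_zero hx
    refine ⟨fun h => ?_, fun h => ?_, fun h => ?_⟩
    · by_cases hd : d = 0
      · simp [h1 (by lia)]
      · simp [e1 hd]
    · have r1 : p • D.w x = 0 := by
        by_cases hd : d = D.δ
        · simp [h1 (by lia)]
        · simp [e3 hd]
      have r2 : D.ε' x • v = 0 := by
        by_cases hd : d = 0
        · simp [h2 (by lia)]
        · simp [e2 hd]
      simp [r1, r2]
    · have r1 : D.z x * p = 0 := by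
        by_cases hd : d = 1
        · simp [h1 (by lia)]
        · simp [e5 hd]
      have r2 : D.ε x * q = 0 := by
        by_cases hd : d = 0
        · simp [h3 (by lia)]
        · simp [e1 hd]
      have r3 : D.β (D.w' x) v = 0 := by
        by_cases hd : d = D.δ'
        · simp [h2 (by lia)]
        · simp [e4 hd]
      simp [r1, r2, r3]

/-- The submodule of `D.proj` formed by the elements with vanishing identity component and with
`V`-component in `H`. -/
def radical (H : Submodule k V) : GradedLeftModule 𝒜 (H × k) where
  act := LinearMap.mk₂ k (fun x p => (D.ε' x • p.1, D.ε x * p.2 + D.β (D.w' x) p.1))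
    (fun x y p => by
      ext
      · simp; module
      · simp; ring)
    (fun c x p => by
      ext
      · simp; module
      · simp; ring)
    (fun x p p' => by
      ext
      · simp
      · simp; ring)
    (fun c x p => by
      ext
      · simp; module
      · simp; ring)
  act_mul x y p := by
    ext
    · simp [D.ε'.mul]; module
    · simp [D.ε.mul, D.w'_mul]; ring
  gr := pairGr H D.δ 1
  act_mem := by
    rintro d e x ⟨v, q⟩ hx ⟨h2, h3⟩
    have hδ := D.δ_add
    dsimp only at h2 h3
    have e1 : d ≠ 0 → D.ε x = 0 := D.ε.apply_eq_zero hx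
    have e2 : d ≠ 0 → D.ε' x = 0 := D.ε'.apply_eq_zero hx
    have e4 : d ≠ D.δ' → D.w' x = 0 := D.w'_eq_zero hx
    refine ⟨fun h => ?_, fun h => ?_⟩
    · by_cases hd : d = 0
      · simp [h2 (by lia)]
      · simp [e2 hd]
    · have r2 : D.ε x * q = 0 := by
        by_cases hd : d = 0
        · simp [h3 (by lia)]
        · simp [e1 hd]
      have r3 : D.β (D.w' x) v = 0 := by
        by_cases hd : d = D.δ'
        · simp [h2 (by lia)]
        · simp [e4 hd]
      simp [r2, r3]

/-- The two-dimensional module with top at `a'` and socle at `a` on which `V'` acts by the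
functional `θ`. -/
def uniserial (θ : V' →ₗ[k] k) : GradedLeftModule 𝒜 (k × k) where
  act := LinearMap.mk₂ k (fun x p => (D.ε' x * p.1, D.ε x * p.2 + θ (D.w' x) * p.1))
    (fun x y p => by ext <;> simp <;> ring)
    (fun c x p => by ext <;> simp <;> ring)
    (fun x p p' => by ext <;> simp <;> ring)
    (fun c x p => by ext <;> simp <;> ring)
  act_mul x y p := by
    ext
    · simp [D.ε'.mul]; ring
    · simp [D.ε.mul, D.w'_mul]; ring
  gr := pairGr k 0 D.δ'
  act_mem := by
    rintro d e x ⟨v, q⟩ hx ⟨h2, h3⟩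
    dsimp only at h2 h3
    have e1 : d ≠ 0 → D.ε x = 0 := D.ε.apply_eq_zero hx
    have e2 : d ≠ 0 → D.ε' x = 0 := D.ε'.apply_eq_zero hx
    have e4 : d ≠ D.δ' → D.w' x = 0 := D.w'_eq_zero hx
    refine ⟨fun h => ?_, fun h => ?_⟩
    · by_cases hd : d = 0
      · simp [h2 (by lia)]
      · simp [e2 hd]
    · have r2 : D.ε x * q = 0 := by
        by_cases hd : d = 0
        · simp [h3 (by lia)]
        · simp [e1 hd]
      have r3 : θ (D.w' x) * v = 0 := by
        by_cases hd : d = D.δ'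
        · simp [h2 (by lia)]
        · simp [e4 hd]
      simp [r2, r3]

@[simp] lemma proj_act (x : A) (p : k × V × k) :
    D.proj.act x p = (D.ε x * p.1, p.1 • D.w x + D.ε' x • p.2.1,
      D.z x * p.1 + D.ε x * p.2.2 + D.β (D.w' x) p.2.1) := rfl

@[simp] lemma radical_act (H : Submodule k V) (x : A) (p : H × k) :
    (D.radical H).act x p = (D.ε' x • p.1, D.ε x * p.2 + D.β (D.w' x) p.1) := rfl

@[simp] lemma uniserial_act (θ : V' →ₗ[k] k) (x : A) (p : k × k) :
    (D.uniserial θ).act x p = (D.ε' x * p.1, D.ε x * p.2 + θ (D.w' x) * p.1) := rfl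

lemma mem_proj_gr {e : ℤ} {p : k × V × k} : p ∈ D.proj.gr e ↔
    (e ≠ 0 → p.1 = 0) ∧ (e ≠ D.δ → p.2.1 = 0) ∧ (e ≠ 1 → p.2.2 = 0) := Iff.rfl

lemma mem_radical_gr {H : Submodule k V} {e : ℤ} {p : H × k} : p ∈ (D.radical H).gr e ↔
    (e ≠ D.δ → p.1 = 0) ∧ (e ≠ 1 → p.2 = 0) := Iff.rfl

lemma mem_uniserial_gr {θ : V' →ₗ[k] k} {e : ℤ} {p : k × k} : p ∈ (D.uniserial θ).gr e ↔
    (e ≠ 0 → p.1 = 0) ∧ (e ≠ D.δ' → p.2 = 0) := Iff.rfl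

/-- `D.proj` is the left ideal of $A$ generated by the idempotent at $a$, embedded by `D.ι`, so it
is projective with generator $(1,0,0)$. -/
lemma acyclic_dual_proj (χ : GradedCharacter 𝒜) (d : ℤ) (s : ℕ) :
    (D.proj.dual χ d).Acyclic (s + 1) := by
  refine D.proj.acyclic_dual_succ χ d (1, 0, 0) D.ι ?_ ?_ ?_ ?_ s
  · simp [mem_proj_gr]
  · intro e p hp
    obtain ⟨h1, h2, h3⟩ := D.mem_proj_gr.1 hp
    obtain ⟨i1, i2, i3, i4, i5, i6⟩ := D.ι_spec p
    rw [D.mem_iff, i1, i2, i3, i4, i5, i6]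
    exact ⟨h1, fun _ => rfl, h2, fun _ => rfl, h3, fun _ => rfl⟩
  · intro a p
    obtain ⟨i1, i2, i3, i4, i5, i6⟩ := D.ι_spec p
    obtain ⟨j1, j2, j3, j4, j5, j6⟩ := D.ι_spec (D.proj.act a p)
    refine D.ext ?_ ?_ ?_ ?_ ?_ ?_
    · rw [j1, D.ε.mul, i1]; rfl
    · rw [j2, D.ε'.mul, i2, mul_zero]
    · rw [j3, D.w_mul, i1, i3, add_comm]; rfl
    · rw [j4, D.w'_mul, i2, i4]; simp
    · rw [j5, D.z_mul, i1, i3, i5]; simp; ring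
    · rw [j6, D.z'_mul, i2, i4, i6]; simp
  · intro p
    obtain ⟨i1, i2, i3, i4, i5, i6⟩ := D.ι_spec p
    simp [i1, i3, i5]

/-- `0 → Hom(k, k) → Hom(P, k) → Hom(rad P, k) → 0` for the module `P` of morphisms starting
at `a`. -/
def splitExactProj (χ : GradedCharacter 𝒜) (d : ℤ) :
    GradedBimodule.SplitExact (GradedBimodule.ofCharacters χ D.ε d k) (D.proj.dual χ d)
      ((D.radical ⊤).dual χ d) where
  i := LinearMap.toSpanSingleton k _ (LinearMap.fst k k (V × k))
  p := LinearMap.applyₗ (1, 0, 0)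
  q := LinearMap.lcomp k k (LinearMap.inr k k (V × k) ∘ₗ
    ((⊤ : Submodule k V).subtype.prodMap LinearMap.id))
  σ := LinearMap.lcomp k k ((Submodule.topEquiv.symm.toLinearMap.prodMap LinearMap.id) ∘ₗ
    LinearMap.snd k k (V × k))
  i_left a m := LinearMap.ext fun _ => by
    simp
    ring
  i_right a m := LinearMap.ext fun _ => by simp [mul_comm, mul_left_comm]
  q_left a m := LinearMap.ext fun _ => by simp
  q_right a m := LinearMap.ext fun _ => by simp
  i_mem e c hc := by
    rw [GradedLeftModule.mem_dual_gr]
    intro j p hp hj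
    by_cases h : j = 0
    · have := GradedBimodule.mem_ofCharacters_gr.1 hc (by lia)
      simp [this]
    · simp [(D.mem_proj_gr.1 hp).1 h]
  p_mem e φ hφ h := hφ 0 _ (by simp [mem_proj_gr]) (by simpa using h)
  q_mem e φ hφ j p hp hj := by
    refine hφ j _ ?_ hj
    obtain ⟨h1, h2⟩ := D.mem_radical_gr.1 hp
    rw [mem_proj_gr]
    exact ⟨fun _ => rfl, fun h => by simp [h1 h], fun h => by simp [h2 h]⟩
  σ_mem e φ hφ j p hp hj := by
    refine hφ j _ ?_ hj
    obtain ⟨h1, h2, h3⟩ := D.mem_proj_gr.1 hp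
    rw [mem_radical_gr]
    exact ⟨fun h => by simp [h2 h], fun h => by simp [h3 h]⟩
  p_i m := by simp
  q_i m := LinearMap.ext fun _ => by simp
  q_σ m := LinearMap.ext fun _ => rfl
  i_p_add m := LinearMap.ext fun p => by
    have h : p = p.1 • (1, 0, 0) + (0, p.2) := by ext <;> simp
    conv_rhs => rw [h]
    simp only [map_add, map_smul]
    simp [mul_comm]

/-- `0 → Hom(T, k) → Hom(P', k) → Hom(H × k, k) → 0` for the module `P'` of morphisms starting at
`a'`, its two-dimensional quotient `T` given by the functional `θ`, and `H = ker θ`. -/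
def splitExactUniserial (χ : GradedCharacter 𝒜) (d : ℤ) (θ : V' →ₗ[k] k) (v₀ : V')
    (hv₀ : θ v₀ = 1) :
    GradedBimodule.SplitExact ((D.uniserial θ).dual χ d) (D.swap.proj.dual χ d)
      ((D.swap.radical (LinearMap.ker θ)).dual χ d) where
  i := LinearMap.lcomp k k (LinearMap.id.prodMap (θ ∘ₗ LinearMap.fst k V' k))
  p := LinearMap.lcomp k k (LinearMap.id.prodMap
    (LinearMap.inl k V' k ∘ₗ LinearMap.toSpanSingleton k V' v₀))
  q := LinearMap.lcomp k k (LinearMap.inr k k (V' × k) ∘ₗ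
    ((LinearMap.ker θ).subtype.prodMap LinearMap.id))
  σ := LinearMap.lcomp k k (((kerProj θ v₀ hv₀).prodMap LinearMap.id) ∘ₗ
    LinearMap.snd k k (V' × k))
  i_left a m := LinearMap.ext fun _ => by simp
  i_right a m := LinearMap.ext fun p => congrArg m <| by
    ext
    · simp [swap]
    · simp [swap]
      ring
  q_left a m := LinearMap.ext fun _ => by simp
  q_right a m := LinearMap.ext fun p => congrArg m <| by ext <;> simp
  i_mem e φ hφ j p hp hj := by
    refine hφ j _ ?_ hj
    obtain ⟨h1, h2, h3⟩ := D.swap.mem_proj_gr.1 hp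
    rw [mem_uniserial_gr]
    exact ⟨fun h => by simp [h1 h], fun h => by simp [h2 h]⟩
  p_mem e φ hφ j p hp hj := by
    refine hφ j _ ?_ hj
    obtain ⟨h1, h2⟩ := D.mem_uniserial_gr.1 hp
    rw [mem_proj_gr]
    exact ⟨fun h => by simp [h1 h], fun h => by simp [h2 h], fun h => by simp⟩
  q_mem e φ hφ j p hp hj := by
    refine hφ j _ ?_ hj
    obtain ⟨h1, h2⟩ := D.swap.mem_radical_gr.1 hp
    rw [mem_proj_gr]
    exact ⟨fun _ => rfl, fun h => by simp [h1 h], fun h => by simp [h2 h]⟩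
  σ_mem e φ hφ j p hp hj := by
    refine hφ j _ ?_ hj
    obtain ⟨h1, h2, h3⟩ := D.swap.mem_proj_gr.1 hp
    rw [mem_radical_gr]
    exact ⟨fun h => by simp [h2 h], fun h => by simp [h3 h]⟩
  p_i m := LinearMap.ext fun p => congrArg m <| by ext <;> simp [hv₀]
  q_i m := LinearMap.ext fun p => (congrArg m (by ext <;> simp)).trans (map_zero m)
  q_σ m := LinearMap.ext fun p => congrArg m <| by ext <;> simp
  i_p_add m := LinearMap.ext fun p => (map_add m _ _).symm.trans <| congrArg m <| by
    ext <;> simp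

/-- `0 → Hom(U, k) → Hom(H × k, k) → Hom(T, k) → 0` for a vector `w₀ ∈ H` and the two-dimensional
module `T` which it generates, with a complement `U` of `w₀` in `H`. -/
def splitExactRadical (χ : GradedCharacter 𝒜) (d : ℤ) (H : Submodule k V) (w₀ : H)
    (ρ : H →ₗ[k] k) (hρ : ρ w₀ = 1) :
    GradedBimodule.SplitExact
      (GradedBimodule.ofCharacters χ D.ε' (d - D.δ) (LinearMap.ker ρ →ₗ[k] k))
      ((D.radical H).dual χ d) ((D.uniserial (D.β.flip w₀)).dual χ (d - D.δ)) where
  i := LinearMap.lcomp k k (kerProj ρ w₀ hρ ∘ₗ LinearMap.fst k H k)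
  p := LinearMap.lcomp k k (LinearMap.inl k H k ∘ₗ (LinearMap.ker ρ).subtype)
  q := LinearMap.lcomp k k ((LinearMap.toSpanSingleton k H w₀).prodMap LinearMap.id)
  σ := LinearMap.lcomp k k (ρ.prodMap LinearMap.id)
  i_left a m := LinearMap.ext fun _ => by simp
  i_right a m := LinearMap.ext fun _ => by simp
  q_left a m := LinearMap.ext fun _ => by simp
  q_right a m := LinearMap.ext fun p => congrArg m <| by
    ext
    · simp [mul_smul]
    · simp [mul_comm]
  i_mem e φ hφ j p hp hj := by
    obtain ⟨h1, h2⟩ := D.mem_radical_gr.1 hp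
    by_cases h : j = D.δ
    · have := GradedBimodule.mem_ofCharacters_gr.1 hφ (by lia)
      simp [this]
    · simp [h1 h]
  p_mem e φ hφ h := by
    ext u
    exact hφ D.δ _ (by simp [mem_radical_gr]) (by lia)
  q_mem e φ hφ j p hp hj := by
    have hδ := D.δ_add
    -- The generator $w_0$ of $T$ sits in degree $\delta$ of the radical, and its socle in degree
    -- $\delta+\delta'=1$.
    refine hφ (j + D.δ) _ ?_ (by lia)
    obtain ⟨h1, h2⟩ := D.mem_uniserial_gr.1 hp
    rw [mem_radical_gr]
    exact ⟨fun h => by simp [h1 (by lia)], fun h => by simp [h2 (by lia)]⟩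
  σ_mem e φ hφ j p hp hj := by
    have hδ := D.δ_add
    refine hφ (j - D.δ) _ ?_ (by lia)
    obtain ⟨h1, h2⟩ := D.mem_radical_gr.1 hp
    rw [mem_uniserial_gr]
    exact ⟨fun h => by simp [h1 (by lia)], fun h => by simp [h2 (by lia)]⟩
  p_i m := LinearMap.ext fun _ => by simp
  q_i m := LinearMap.ext fun _ => by simp
  q_σ m := LinearMap.ext fun p => congrArg m <| by ext <;> simp [hρ]
  i_p_add m := LinearMap.ext fun p => (map_add m _ _).symm.trans <| congrArg m <| by
    ext <;> simp

/-- `χ` is the character of the simple module at `a` or `a'`, and `c`, `c'` are chosen such that a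
path of length `ℓ` and degree `d` to the object of `χ` has `ℓ = 2 d + c` if it starts at `a` and
`ℓ = 2 d + c'` if it starts at `a'`. -/
structure Target (D : TwoVertexAlgebra 𝒜 V V') (χ : GradedCharacter 𝒜) (c c' : ℤ) : Prop where
  c'_eq : c' = c + 2 * D.δ - 1
  eq_or : (χ = D.ε ∧ c = 0) ∨ (χ = D.ε' ∧ c' = 0)

lemma Target.swap {D : TwoVertexAlgebra 𝒜 V V'} {χ : GradedCharacter 𝒜} {c c' : ℤ}
    (h : D.Target χ c c') : D.swap.Target χ c' c where
  c'_eq := by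
    have h1 := h.c'_eq
    have h2 := D.δ_add
    simp only [TwoVertexAlgebra.swap]
    lia
  eq_or := h.eq_or.symm

/-- The vanishing of the extensions by `χ` of the simple module at `a`, and of the two-dimensional
modules with top at `a'`, off the diagonal, with `s` arguments. -/
def Linear (D : TwoVertexAlgebra 𝒜 V V') (χ : GradedCharacter 𝒜) (c c' : ℤ) (s : ℕ) : Prop :=
  (∀ d, (s : ℤ) < 2 * d + c → (GradedBimodule.ofCharacters χ D.ε d k).Acyclic s) ∧
    ∀ θ : V' →ₗ[k] k, θ ≠ 0 → ∀ d, (s : ℤ) < 2 * d + c' →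
      ((D.uniserial θ).dual χ d).Acyclic s

/-- A nonzero $w_0\in H$ generates a uniserial submodule, with nonzero functional $\beta(\cdot,w_0)$
by nondegeneracy. The quotient is a sum of simples at $a'$. Both are generated in degree $\delta$,
hence the shift $d-\delta$, and both are covered at stage $s$. -/
lemma Linear.radical [GradedAlgebra 𝒜] [FiniteDimensional k V]
    {D : TwoVertexAlgebra 𝒜 V V'} {χ : GradedCharacter 𝒜} {c c' : ℤ} {s : ℕ}
    (h : D.Linear χ c c' s) (h' : D.swap.Linear χ c' c s) (H : Submodule k V) (w₀ : V)
    (hw₀ : w₀ ∈ H) (hne : w₀ ≠ 0) {d : ℤ} (hd : (s : ℤ) < 2 * (d - D.δ) + c') :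
    ((D.radical H).dual χ d).Acyclic s := by
  -- The kernel of $\rho$ is a complement of $w_0$ in $H$, as the split sequence requires.
  obtain ⟨ρ, hρ⟩ : ∃ ρ : H →ₗ[k] k, ρ ⟨w₀, hw₀⟩ = 1 := by
    obtain ⟨φ, hφ⟩ : ∃ φ : H →ₗ[k] k, φ ⟨w₀, hw₀⟩ ≠ 0 := by
      by_contra! hφ
      exact hne (congrArg Subtype.val ((Module.forall_dual_apply_eq_zero_iff k _).1 hφ))
    exact ⟨(φ ⟨w₀, hw₀⟩)⁻¹ • φ, by simp [hφ]⟩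
  refine (D.splitExactRadical χ d H ⟨w₀, hw₀⟩ ρ hρ).acyclic_middle ?_ ?_
  · exact GradedBimodule.acyclic_ofCharacters_of_basis (Module.finBasis k _) (h'.1 _ hd)
  · exact h.2 _ (D.β_ne w₀ hne) _ hd

/-- The syzygy of the simple at $a$ is the full radical of its projective cover; that of the
uniserial module for $\theta$ is the part of the other radical over $\ker\theta$. Passing to the
syzygy strips one arrow from a path, and `Target` is normalised so that the bound drops by exactly
one. -/
lemma Linear.succ [GradedAlgebra 𝒜] [FiniteDimensional k V] [FiniteDimensional k V']
    {D : TwoVertexAlgebra 𝒜 V V'} {χ : GradedCharacter 𝒜} {c c' : ℤ} {s : ℕ}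
    (hc : D.Target χ c c') (h : D.Linear χ c c' s) (h' : D.swap.Linear χ c' c s) :
    D.Linear χ c c' (s + 1) := by
  have h1 := hc.c'_eq
  have h2 := D.δ_add
  refine ⟨fun d hd => ?_, fun θ hθ d hd => ?_⟩
  -- The zero functional is a device to obtain some nonzero vector of $V$.
  · obtain ⟨v, hv, -⟩ := D.exists_mem_ker 0
    refine (D.splitExactProj χ d).acyclic_left_succ (D.acyclic_dual_proj χ d s)
      (h.radical h' ⊤ v trivial hv ?_)
    push_cast at hd
    lia
  -- This is where dimension at least 2 matters: $\ker\theta$ has to contain a nonzero vector to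
  -- generate the next uniserial module.
  · obtain ⟨v, hv, hθv⟩ := D.exists_mem_ker' θ
    obtain ⟨v₁, hv₁⟩ := DFunLike.ne_iff.1 hθ
    have hv₀ : θ ((θ v₁)⁻¹ • v₁) = 1 := by
      rw [map_smul, smul_eq_mul, inv_mul_cancel₀ (by simpa using hv₁)]
    refine (D.splitExactUniserial χ d θ _ hv₀).acyclic_left_succ (D.swap.acyclic_dual_proj χ d s)
      (h'.radical h _ v hθv hv ?_)
    push_cast at hd
    simp only [TwoVertexAlgebra.swap]
    lia

/-- In degree 0 this is about homomorphisms to the simple module of $\chi$. On a generator they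
vanish either because its object is the wrong one, seen by an idempotent, or because its degree is.
-/
lemma Target.linear_zero {D : TwoVertexAlgebra 𝒜 V V'} {χ : GradedCharacter 𝒜} {c c' : ℤ}
    (hc : D.Target χ c c') : D.Linear χ c c' 0 := by
  have e1 : D.ε (D.ι (1, 0, 0)) = 1 := (D.ι_spec _).1
  have e1' : D.ε' (D.ι (1, 0, 0)) = 0 := (D.ι_spec _).2.1
  have e2 : D.ε' (D.ι' (1, 0, 0)) = 1 := (D.ι'_spec _).1
  have e2' : D.ε (D.ι' (1, 0, 0)) = 0 := (D.ι'_spec _).2.1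
  have e3 : D.w' (D.ι' (1, 0, 0)) = 0 := (D.ι'_spec _).2.2.1
  refine ⟨fun d hd f hf hdf => ?_, fun θ hθ d hd f hf hdf => ?_⟩
  · refine (Submodule.mem_bot k).2 ?_
    ext a
    have hfa := hf (fun _ => 0) a (fun i => i.elim0)
    rw [GradedBimodule.mem_ofCharacters_gr] at hfa
    rcases hc.eq_or with ⟨h, h0⟩ | ⟨h, h0⟩
    -- Same object: here $c=0$, so $d>0$ and the target has nothing in degree 0.
    · simpa using hfa (by simp; lia)
    -- Different objects: the idempotent at $a$ acts by 0 on the left and by 1 on the right.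
    · have := congrArg (fun F => F (fun _ => D.ι (1, 0, 0))) hdf
      subst h
      simp only [GradedBimodule.d_apply, GradedBimodule.ofCharacters_left, e1',
        GradedBimodule.ofCharacters_right, e1] at this
      rw [Subsingleton.elim a fun _ => D.ι (1, 0, 0)]
      simpa using this
  · refine (Submodule.mem_bot k).2 ?_
    ext a : 1
    have hfa := hf (fun _ => 0) a (fun i => i.elim0)
    rw [GradedLeftModule.mem_dual_gr] at hfa
    have hact (x : A) (n : k × k) : χ x * f a n = f a ((D.uniserial θ).act x n) := by
      have := congrArg (fun F => F (fun _ => x) n) hdf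
      simp only [GradedBimodule.d_apply, LinearMap.add_apply, LinearMap.smul_apply,
        GradedLeftModule.dual_left_apply, GradedLeftModule.dual_right_apply] at this
      rw [Subsingleton.elim a fun _ => x, ← sub_eq_zero, sub_eq_add_neg]
      simpa using this
    have h1 : f a (1, 0) = 0 := by
      rcases hc.eq_or with ⟨h, h0⟩ | ⟨h, h0⟩
      · have := hact (D.ι' (1, 0, 0)) (1, 0)
        rw [h, e2', uniserial_act, e2, e2', e3] at this
        simpa using this.symm
      · exact hfa 0 _ (by simp [mem_uniserial_gr]) (by simp; lia)
    -- The socle is reached from the top $(1,0)$ by an element of $V'$ on which $\theta$ is 1, so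
    -- its value follows from `h1`.
    have h2 : f a (0, 1) = 0 := by
      obtain ⟨v₁, hv₁⟩ := DFunLike.ne_iff.1 hθ
      obtain ⟨i1, i2, i3, -⟩ := D.ι'_spec (0, (θ v₁)⁻¹ • v₁, 0)
      have := hact (D.ι' (0, (θ v₁)⁻¹ • v₁, 0)) (1, 0)
      rw [h1, mul_zero, uniserial_act, i1, i2, i3, map_smul, smul_eq_mul,
        inv_mul_cancel₀ (by simpa using hv₁)] at this
      simpa using this.symm
    ext
    · simpa using h1
    · simpa using h2

/-- The two objects must be treated together, since each syzygy at one object involves modules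
generated at the other. -/
theorem Target.linear [GradedAlgebra 𝒜] [FiniteDimensional k V] [FiniteDimensional k V']
    {D : TwoVertexAlgebra 𝒜 V V'} {χ : GradedCharacter 𝒜} {c c' : ℤ}
    (hc : D.Target χ c c') (s : ℕ) : D.Linear χ c c' s ∧ D.swap.Linear χ c' c s := by
  induction s with
  | zero => exact ⟨hc.linear_zero, hc.swap.linear_zero⟩
  | succ s ih => exact ⟨ih.1.succ hc ih.2, ih.2.succ hc.swap ih.1⟩

end TwoVertexAlgebra

end TwoVertices

end Hochschild

namespace Hochschild

/-! ### Explicit differentials for cochains with one and two arguments. -/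

section LowDegrees

variable {k A M : Type*} [CommRing k] [Ring A] [Algebra k A] [AddCommGroup M] [Module k M]
  {𝒜 : ℤ → Submodule k A}

/-- A cochain with two arguments as a bilinear map. -/
def bilin (f : BimoduleCochain k A M 2) : A →ₗ[k] A →ₗ[k] M :=
  LinearMap.mk₂ k (fun x y => f ![x, y]) (fun x x' y => f.cons_add ![y] x x')
    (fun c x y => f.cons_smul ![y] c x)
    (fun x y y' => (f.curryLeft x).cons_add ![] y y')
    (fun c x y => (f.curryLeft x).cons_smul ![] c y)

lemma bilin_apply (f : BimoduleCochain k A M 2) (x y : A) : bilin f x y = f ![x, y] := rfl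

/-- A linear map as a cochain with one argument. -/
def ofLinear (u : A →ₗ[k] M) : BimoduleCochain k A M 1 :=
  MultilinearMap.ofSubsingleton k A M 0 u

lemma ofLinear_apply (u : A →ₗ[k] M) (a : Fin 1 → A) : ofLinear u a = u (a 0) := rfl

lemma ext_bilin {f f' : BimoduleCochain k A M 2} (h : ∀ x y, bilin f x y = bilin f' x y) :
    f = f' := by
  ext a
  have ha : a = ![a 0, a 1] := by
    funext i
    fin_cases i <;> rfl
  rw [ha]
  exact h _ _

namespace GradedBimodule

lemma d_two (B : GradedBimodule 𝒜 M) (f : BimoduleCochain k A M 2) (x y z : A) :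
    B.d 2 f ![x, y, z] = B.left x (bilin f y z) - bilin f (x * y) z + bilin f x (y * z) -
      B.right z (bilin f x y) := by
  have e1 : (fun i : Fin 2 => (![x, y, z] : Fin 3 → A) i.succ) = ![y, z] := by
    funext i
    fin_cases i <;> rfl
  have e2 : (fun i : Fin 2 => (![x, y, z] : Fin 3 → A) i.castSucc) = ![x, y] := by
    funext i
    fin_cases i <;> rfl
  have e3 : (0 : Fin 2).castSucc.contractNth (· * ·) (![x, y, z] : Fin 3 → A) = ![x * y, z] := by
    funext i
    fin_cases i <;> rfl
  have e4 : (1 : Fin 2).castSucc.contractNth (· * ·) (![x, y, z] : Fin 3 → A) = ![x, y * z] := by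
    funext i
    fin_cases i <;> rfl
  rw [d_apply, e1, e2, Fin.sum_univ_two, e3, e4]
  simp only [bilin_apply]
  have e5 : (![x, y, z] : Fin 3 → A) (Fin.last 2) = z := rfl
  rw [e5]
  simp
  abel

lemma d_ofLinear (B : GradedBimodule 𝒜 M) (u : A →ₗ[k] M) (x y : A) :
    bilin (B.d 1 (ofLinear u)) x y = B.left x (u y) - u (x * y) + B.right y (u x) := by
  rw [bilin_apply, d_apply]
  simp only [ofLinear_apply, Fin.sum_univ_one]
  have e3 : (0 : Fin 1).castSucc.contractNth (· * ·) (![x, y] : Fin 2 → A) 0 = x * y := rfl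
  have e5 : (![x, y] : Fin 2 → A) (Fin.last 1) = y := rfl
  have e6 : (![x, y] : Fin 2 → A) (Fin.succ 0) = y := rfl
  have e7 : (![x, y] : Fin 2 → A) (Fin.castSucc 0) = x := rfl
  rw [e3, e5, e6, e7]
  simp
  abel

lemma bilin_mem {B : GradedBimodule 𝒜 M} {f : BimoduleCochain k A M 2} (hf : f ∈ B.homogeneous 2)
    {d e : ℤ} {x y : A} (hx : x ∈ 𝒜 d) (hy : y ∈ 𝒜 e) : bilin f x y ∈ B.gr (d + e) := by
  have := hf ![d, e] ![x, y] (by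
    intro i
    fin_cases i
    · exact hx
    · exact hy)
  simpa [bilin_apply] using this

end GradedBimodule

end LowDegrees

/-! ### Two-cocycles with coefficients in a simple bimodule at one object. -/

namespace TwoVertexAlgebra

variable {k A V V' : Type*} [Field k] [Ring A] [Algebra k A] [AddCommGroup V] [Module k V]
  [AddCommGroup V'] [Module k V'] {𝒜 : ℤ → Submodule k A}

/-- A cocycle with two arguments and coefficients in the simple bimodule at `a` in degree `1`
is a coboundary if its values on `V' × V` are a multiple of the composition. -/
theorem mem_coboundaries_two [GradedAlgebra 𝒜] (D : TwoVertexAlgebra 𝒜 V V')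
    {F : BimoduleCochain k A k 2}
    (hF : F ∈ (GradedBimodule.ofCharacters D.ε D.ε 1 k).homogeneous 2)
    (hdF : (GradedBimodule.ofCharacters D.ε D.ε 1 k).d 2 F = 0) (c : k)
    (hc : ∀ φ v, bilin F (D.ι' (0, φ, 0)) (D.ι (0, v, 0)) = c * D.β φ v) :
    F ∈ (GradedBimodule.ofCharacters D.ε D.ε 1 k).coboundaries 2 := by
  set B := GradedBimodule.ofCharacters D.ε D.ε 1 k with hB
  have cocycle {f : BimoduleCochain k A k 2} (hf : B.d 2 f = 0) (x y z : A) :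
      D.ε x * bilin f y z - bilin f (x * y) z + bilin f x (y * z) - D.ε z * bilin f x y = 0 := by
    have h := congrArg (fun f => f ![x, y, z]) hf
    rw [B.d_two] at h
    exact h
  have gr0 {d e : ℤ} {x y : A} (hx : x ∈ 𝒜 d) (hy : y ∈ 𝒜 e) (h : d + e ≠ 1) :
      bilin F x y = 0 := GradedBimodule.bilin_mem hF hx hy h
  set e := D.ι (1, 0, 0) with he
  obtain ⟨e1, e2, e3, e4, e5, e6⟩ := D.ι_spec (1, 0, 0)
  rw [← he] at e1 e2 e3 e4 e5 e6
  set ξ := D.ι (0, 0, 1) with hξ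
  obtain ⟨x1, x2, x3, x4, x5, x6⟩ := D.ι_spec (0, 0, 1)
  rw [← hξ] at x1 x2 x3 x4 x5 x6
  dsimp only at e1 e3 e5 x1 x3 x5
  have he0 : e ∈ 𝒜 0 := D.mem_iff.2 (by simp [e3, e4, e5, e6])
  have hee : e * e = e := by
    apply D.ext <;> simp [D.ε.mul, D.ε'.mul, D.w_mul, D.w'_mul, D.z_mul, D.z'_mul,
      e1, e2, e3, e4, e5, e6]
  have heξ : e * ξ = ξ := by
    apply D.ext <;> simp [D.ε.mul, D.ε'.mul, D.w_mul, D.w'_mul, D.z_mul, D.z'_mul,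
      e1, e2, e3, e4, e5, e6, x1, x2, x3, x4, x5, x6]
  have hξe : ξ * e = ξ := by
    apply D.ext <;> simp [D.ε.mul, D.ε'.mul, D.w_mul, D.w'_mul, D.z_mul, D.z'_mul,
      e1, e2, e3, e4, e5, e6, x1, x2, x3, x4, x5, x6]
  have hle (x : A) : e * x = D.ε x • e + D.ι' (0, D.w' x, 0) + D.z x • ξ := by
    obtain ⟨y1, y2, y3, y4, y5, y6⟩ := D.ι'_spec (0, D.w' x, 0)
    apply D.ext <;> simp [D.ε.mul, D.ε'.mul, D.w_mul, D.w'_mul, D.z_mul, D.z'_mul,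
      e1, e2, e3, e4, e5, e6, x1, x2, x3, x4, x5, x6, y1, y2, y3, y4, y5, y6]
  have hre (x : A) : x * e = D.ε x • e + D.ι (0, D.w x, 0) + D.z x • ξ := by
    obtain ⟨y1, y2, y3, y4, y5, y6⟩ := D.ι_spec (0, D.w x, 0)
    apply D.ext <;> simp [D.ε.mul, D.ε'.mul, D.w_mul, D.w'_mul, D.z_mul, D.z'_mul,
      e1, e2, e3, e4, e5, e6, x1, x2, x3, x4, x5, x6, y1, y2, y3, y4, y5, y6]
  have hφv (φ : V') (v : V) : D.ι' (0, φ, 0) * D.ι (0, v, 0) = D.β φ v • ξ := by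
    obtain ⟨y1, y2, y3, y4, y5, y6⟩ := D.ι_spec (0, v, 0)
    obtain ⟨z1, z2, z3, z4, z5, z6⟩ := D.ι'_spec (0, φ, 0)
    apply D.ext <;> simp [D.ε.mul, D.ε'.mul, D.w_mul, D.w'_mul, D.z_mul, D.z'_mul,
      x1, x2, x3, x4, x5, x6, y1, y2, y3, y4, y5, y6, z1, z2, z3, z4, z5, z6]
  have hvv (v v' : V) : D.ι (0, v, 0) * D.ι (0, v', 0) = 0 := by
    obtain ⟨y1, y2, y3, y4, y5, y6⟩ := D.ι_spec (0, v, 0)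
    obtain ⟨z1, z2, z3, z4, z5, z6⟩ := D.ι_spec (0, v', 0)
    apply D.ext <;> simp [D.ε.mul, D.ε'.mul, D.w_mul, D.w'_mul, D.z_mul, D.z'_mul,
      y1, y2, y3, y4, y5, y6, z1, z2, z3, z4, z5, z6]
  have hφφ (v v' : V') : D.ι' (0, v, 0) * D.ι' (0, v', 0) = 0 := by
    obtain ⟨y1, y2, y3, y4, y5, y6⟩ := D.ι'_spec (0, v, 0)
    obtain ⟨z1, z2, z3, z4, z5, z6⟩ := D.ι'_spec (0, v', 0)
    apply D.ext <;> simp [D.ε.mul, D.ε'.mul, D.w_mul, D.w'_mul, D.z_mul, D.z'_mul,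
      y1, y2, y3, y4, y5, y6, z1, z2, z3, z4, z5, z6]
  have hεv (v : V) : D.ε (D.ι (0, v, 0)) = 0 := (D.ι_spec _).1
  have hεφ (φ : V') : D.ε (D.ι' (0, φ, 0)) = 0 := (D.ι'_spec _).2.1
  have hzl (x : A) : D.z (e * x) = D.z x := by simp [D.z_mul, e1, e4, e5]
  have hzr (x : A) : D.z (x * e) = D.z x := by simp [D.z_mul, e1, e3, e5]
  have hFee : bilin F e e = 0 := gr0 he0 he0 (by simp)
  -- The first two terms normalise $F$ so that it vanishes when an argument is the idempotent $e$.
  -- The last one makes $u(\xi)=-c$, so that $du$ equals $c\beta$ on $V'\times V$.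
  let u : A →ₗ[k] k := bilin F e + (bilin F).flip e ∘ₗ LinearMap.mulLeft k e - c • D.z
  have hu (x : A) : u x = bilin F e x + bilin F (e * x) e - c * D.z x := rfl
  have hu_hom : ofLinear u ∈ B.homogeneous 1 := by
    intro m a ha hm
    rw [ofLinear_apply, hu]
    have h0 := ha 0
    simp only [Finset.univ_unique, Fin.default_eq_zero, Finset.sum_singleton] at hm
    rw [gr0 he0 h0 (by simpa using hm), gr0 (SetLike.mul_mem_graded he0 h0) he0 (by simpa using hm),
      D.z_eq_zero h0 hm]
    simp
  refine ⟨ofLinear u, hu_hom, ?_⟩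
  set F' := F - B.d 1 (ofLinear u) with hF'
  have hdF' : B.d 2 F' = 0 := by rw [hF', map_sub, hdF, B.d_d, sub_zero]
  have hbF' (x y : A) : bilin F' x y =
      bilin F x y - (D.ε x * u y - u (x * y) + D.ε y * u x) := by
    have h : bilin F' x y = bilin F x y - bilin (B.d 1 (ofLinear u)) x y := rfl
    rw [h, B.d_ofLinear]
    rfl
  have hFe (x : A) : bilin F e (e * x) = 0 := by
    have := cocycle hdF e e x
    rw [hee, e1, hFee] at this
    linear_combination this
  have hFxe (x : A) : bilin F (e * x * e) e = 0 := by
    have := cocycle hdF (e * x) e e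
    rw [hee, e1, hFee] at this
    linear_combination -this
  have hue : u e = 0 := by rw [hu, hee, hFee, e5]; simp
  have hl (x : A) : bilin F' e x = 0 := by
    have h1 := hFe x
    rw [hbF', e1, hue, hu, hu, hzl, ← mul_assoc, hee, h1]
    ring
  have hr (x : A) : bilin F' x e = 0 := by
    have h1 := cocycle hdF e x e
    have h2 := hFxe x
    rw [e1] at h1
    rw [hbF', e1, hue, hu, hu, hzr, ← mul_assoc, h2]
    linear_combination h1
  have huξ : u ξ = -c := by
    have h1 := hFe ξ
    have h2 := hFxe ξ
    rw [heξ] at h1 h2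
    rw [hξe] at h2
    rw [hu, heξ, h1, h2, x5]
    ring
  have hφv' (φ : V') (v : V) : bilin F' (D.ι' (0, φ, 0)) (D.ι (0, v, 0)) = 0 := by
    rw [hbF', hc, hεv, hεφ, hφv, map_smul, huξ, smul_eq_mul]
    ring
  -- Since $\beta\ne0$, $\xi$ is a multiple of a product $\varphi_0v_0$; the cocycle identity then
  -- propagates the vanishing to all pairs involving $\xi$.
  obtain ⟨φ₀, v₀, h₀⟩ : ∃ φ₀ v₀, D.β φ₀ v₀ ≠ 0 := by
    obtain ⟨v₀, hv₀, -⟩ := D.exists_mem_ker 0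
    obtain ⟨φ₀, hφ₀⟩ := DFunLike.ne_iff.1 (D.β_ne v₀ hv₀)
    exact ⟨φ₀, v₀, hφ₀⟩
  have hξv (v : V) : bilin F' ξ (D.ι (0, v, 0)) = 0 := by
    have := cocycle hdF' (D.ι' (0, φ₀, 0)) (D.ι (0, v₀, 0)) (D.ι (0, v, 0))
    rw [hφv, hvv, hεφ, hεv] at this
    simpa [h₀] using this
  have hφξ (φ : V') : bilin F' (D.ι' (0, φ, 0)) ξ = 0 := by
    have := cocycle hdF' (D.ι' (0, φ, 0)) (D.ι' (0, φ₀, 0)) (D.ι (0, v₀, 0))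
    rw [hφv, hφφ, hεφ, hεv] at this
    simpa [h₀] using this
  have hξξ : bilin F' ξ ξ = 0 := by
    have := cocycle hdF' ξ (D.ι' (0, φ₀, 0)) (D.ι (0, v₀, 0))
    have h : ξ * D.ι' (0, φ₀, 0) = 0 := by
      obtain ⟨z1, z2, z3, z4, z5, z6⟩ := D.ι'_spec (0, φ₀, 0)
      apply D.ext <;> simp [D.ε.mul, D.ε'.mul, D.w_mul, D.w'_mul, D.z_mul, D.z'_mul,
        x1, x2, x3, x4, x5, x6, z1, z2, z3, z4, z5, z6]
    rw [hφv, h, x1, hεv] at this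
    simpa [h₀] using this
  refine (sub_eq_zero.1 (ext_bilin (f := F') (f' := 0) fun x y => ?_)).symm
  have hy := cocycle hdF' x y e
  have hx := cocycle hdF' e x (y * e)
  rw [hl, hl, e1] at hx
  rw [hr, hr, e1] at hy
  -- A normalised cocycle with these coefficients only sees morphisms ending at $a$ in the first
  -- argument and starting at $a$ in the second. By `hle` and `hre` these are spanned by $e$, $\xi$
  -- and $V'$, respectively $V$.
  have key : bilin F' x y = bilin F' (e * x) (y * e) := by
    linear_combination -hy + hx
  rw [key, hle, hre]
  have h0 : bilin (0 : BimoduleCochain k A k 2) x y = 0 := rfl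
  simp [hl, hr, hφv', hξv, hφξ, hξξ, h0]

end TwoVertexAlgebra

end Hochschild

namespace Hochschild

/-! ### The algebra as a bimodule over itself, and removal of one layer of the coefficients. -/

section SelfCoefficients

variable {k A M M'' : Type*} [CommRing k] [Ring A] [Algebra k A] [AddCommGroup M] [Module k M]
  [AddCommGroup M''] [Module k M'']

/-- The algebra `A` as a graded bimodule over itself, shifted by `t`, with the left action
twisted by the Koszul sign. -/
def selfBimodule (𝒜 : ℤ → Submodule k A) [GradedAlgebra 𝒜] (t : ℤ) : GradedBimodule 𝒜 A where
  left := LinearMap.mul k A ∘ₗ koszulSign 𝒜 t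
  right := (LinearMap.mul k A).flip
  left_mul a b m := by simp [koszulSign_mul, mul_assoc]
  right_mul a b m := by simp [mul_assoc]
  left_right a b m := by simp [mul_assoc]
  gr e := 𝒜 (e + t)
  left_mem ha hm := by
    rw [add_assoc, LinearMap.comp_apply, koszulSign_apply 𝒜 t ha, map_zsmul, LinearMap.smul_apply]
    exact zsmul_mem (SetLike.mul_mem_graded ha hm) _
  right_mem ha hm := by
    rw [add_right_comm]
    exact SetLike.mul_mem_graded hm ha

variable {𝒜 : ℤ → Submodule k A}

/-- The complex of `selfBimodule` is definitionally the original one, signs and grading included. -/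
lemma subsingleton_cohomology [GradedAlgebra 𝒜] {t : ℤ} {s : ℕ}
    (h : (selfBimodule 𝒜 t).Acyclic s) : Subsingleton (cohomology 𝒜 t s) := by
  rw [Submodule.Quotient.subsingleton_iff, eq_top_iff]
  rintro ⟨f, hf, hdf⟩ -
  have := h f hf hdf
  cases s <;> exact this

namespace GradedBimodule

/-- Every homogeneous cocycle with values in `W` is a coboundary. -/
def AcyclicOn (B : GradedBimodule 𝒜 M) (W : Submodule k M) (s : ℕ) : Prop :=
  ∀ f ∈ B.homogeneous s, B.d s f = 0 → (∀ a, f a ∈ W) → f ∈ B.coboundaries s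

/-- This peels off a quotient layer $M''$ of $W$. The condition `hq` concerns only components
$q\circ f$ of genuine cocycles $f$ in $M$, which is weaker than acyclicity of $M''$; the borderline
case depends on this, because there the layer is not covered by the degree bound. -/
lemma acyclicOn_of_inf_ker [GradedAlgebra 𝒜] (B : GradedBimodule 𝒜 M) (B'' : GradedBimodule 𝒜 M'')
    (W : Submodule k M) (hWl : ∀ a, ∀ m ∈ W, B.left a m ∈ W)
    (hWr : ∀ a, ∀ m ∈ W, B.right a m ∈ W) (q : M →ₗ[k] M'') (σ : M'' →ₗ[k] M)
    (hσW : ∀ m, σ m ∈ W) (hσ : ∀ e, ∀ m ∈ B''.gr e, σ m ∈ B.gr e) (hqσ : ∀ m, q (σ m) = m)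
    (hl : ∀ a, ∀ m ∈ W, q (B.left a m) = B''.left a (q m))
    (hr : ∀ a, ∀ m ∈ W, q (B.right a m) = B''.right a (q m)) {s : ℕ}
    (hq : ∀ f ∈ B.homogeneous s, B.d s f = 0 → (∀ a, f a ∈ W) →
      B''.d s (q.compMultilinearMap f) = 0 → q.compMultilinearMap f ∈ B''.coboundaries s)
    (h : B.AcyclicOn (W ⊓ LinearMap.ker q) s) : B.AcyclicOn W s := by
  intro f hf hdf hfW
  have hdq : B''.d s (q.compMultilinearMap f) = 0 := by
    rw [d_comp_of_mem q W hl hr hfW, hdf]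
    ext
    simp
  obtain ⟨u, hu, huq⟩ := exists_sub_mem_ker B B'' W hWl hWr q σ hσW hσ hqσ hl hr hfW
    (hq f hf hdf hfW hdq)
  have := h (f - u) (sub_mem hf (B.coboundaries_le_homogeneous s hu))
    (by rw [map_sub, hdf, B.coboundaries_le_ker hu, sub_zero]) huq
  simpa using add_mem this hu

end GradedBimodule

end SelfCoefficients

end Hochschild

/-! ### `SphAlg g` as a two-vertex algebra, and its filtration. -/

namespace SphAlg

open Hochschild

variable {k V : Type*} [Field k] [AddCommGroup V] [Module k V] {g : V →ₗ[k] V}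

/-- The coefficient of `id_X` as a character. -/
def charX (g : V →ₗ[k] V) : GradedCharacter (grading g) where
  toFun := idX
  map_add' _ _ := rfl
  map_smul' _ _ := rfl
  map_mul _ _ := rfl
  eq_zero ha hd := (ha.1 hd).1

/-- The coefficient of `id_Y` as a character. -/
def charY (g : V →ₗ[k] V) : GradedCharacter (grading g) where
  toFun := idY
  map_add' _ _ := rfl
  map_smul' _ _ := rfl
  map_mul _ _ := rfl
  eq_zero ha hd := (ha.1 hd).2.1

@[simp] lemma charX_apply (x : SphAlg g) : charX g x = x.idX := rfl

@[simp] lemma charY_apply (x : SphAlg g) : charY g x = x.idY := rfl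

/-- The component in `Hom(X,Y)`. -/
def lhXY (g : V →ₗ[k] V) : SphAlg g →ₗ[k] V where
  toFun := hXY
  map_add' _ _ := rfl
  map_smul' _ _ := rfl

/-- The component in `Hom(Y,X)`. -/
def lhYX (g : V →ₗ[k] V) : SphAlg g →ₗ[k] Module.Dual k V where
  toFun := hYX
  map_add' _ _ := rfl
  map_smul' _ _ := rfl

/-- The coefficient of `ξ_X`. -/
def lxiX (g : V →ₗ[k] V) : SphAlg g →ₗ[k] k where
  toFun := xiX
  map_add' _ _ := rfl
  map_smul' _ _ := rfl

/-- The coefficient of `ξ_Y`. -/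
def lxiY (g : V →ₗ[k] V) : SphAlg g →ₗ[k] k where
  toFun := xiY
  map_add' _ _ := rfl
  map_smul' _ _ := rfl

@[simp] lemma lhXY_apply (x : SphAlg g) : lhXY g x = x.hXY := rfl
@[simp] lemma lhYX_apply (x : SphAlg g) : lhYX g x = x.hYX := rfl
@[simp] lemma lxiX_apply (x : SphAlg g) : lxiX g x = x.xiX := rfl
@[simp] lemma lxiY_apply (x : SphAlg g) : lxiY g x = x.xiY := rfl

/-- The morphisms which start at `X`. -/
def fromX (g : V →ₗ[k] V) : k × V × k →ₗ[k] SphAlg g where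
  toFun p := ⟨p.1, 0, p.2.1, 0, p.2.2, 0⟩
  map_add' p q := by ext <;> simp
  map_smul' c p := by ext <;> simp

/-- The morphisms which start at `Y`. -/
def fromY (g : V →ₗ[k] V) : k × Module.Dual k V × k →ₗ[k] SphAlg g where
  toFun p := ⟨0, p.1, 0, p.2.1, 0, p.2.2⟩
  map_add' p q := by ext <;> simp
  map_smul' c p := by ext <;> simp

lemma fromX_apply (p : k × V × k) : fromX g p = ⟨p.1, 0, p.2.1, 0, p.2.2, 0⟩ := rfl

lemma fromY_apply (p : k × Module.Dual k V × k) :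
    fromY g p = ⟨0, p.1, 0, p.2.1, 0, p.2.2⟩ := rfl

/-- Rank–nullity; through this the hypothesis $n\ge2$ enters the Ext computation. -/
lemma exists_ne_zero_mem_ker {W : Type*} [AddCommGroup W] [Module k W] [FiniteDimensional k W]
    (hW : 2 ≤ Module.finrank k W) (θ : W →ₗ[k] k) : ∃ v, v ≠ 0 ∧ θ v = 0 := by
  have h1 := LinearMap.finrank_range_add_finrank_ker θ
  have h2 := (LinearMap.range θ).finrank_le
  rw [Module.finrank_self] at h2
  have : Nontrivial (LinearMap.ker θ) := (Module.finrank_pos_iff (R := k)).1 (by lia)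
  obtain ⟨v, hv⟩ := exists_ne (0 : LinearMap.ker θ)
  exact ⟨v, by simpa using hv, v.2⟩

/-- The algebra `SphAlg g` as a two-vertex algebra. -/
def twoVertex [FiniteDimensional k V] (hg : Function.Injective g)
    (hV : 2 ≤ Module.finrank k V) :
    TwoVertexAlgebra (grading g) V (Module.Dual k V) where
  ε := charX g
  ε' := charY g
  w := lhXY g
  w' := lhYX g
  z := lxiX g
  z' := lxiY g
  β := LinearMap.lcomp k k g
  β' := Module.Dual.eval k V
  δ := 0
  δ' := 1
  δ_add := rfl
  ext h1 h2 h3 h4 h5 h6 := SphAlg.ext h1 h2 h3 h4 h5 h6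
  w_mul _ _ := rfl
  w'_mul _ _ := rfl
  z_mul _ _ := rfl
  z'_mul _ _ := rfl
  mem_iff := by
    intro d x
    rw [mem_grading]
    simp only [charX_apply, charY_apply, lhXY_apply, lhYX_apply, lxiX_apply, lxiY_apply]
    tauto
  ι := fromX g
  ι' := fromY g
  ι_spec p := ⟨rfl, rfl, rfl, rfl, rfl, rfl⟩
  ι'_spec p := ⟨rfl, rfl, rfl, rfl, rfl, rfl⟩
  β_ne v hv h := by
    refine hv (hg ?_)
    rw [map_zero]
    exact (Module.forall_dual_apply_eq_zero_iff k _).1 fun φ => LinearMap.congr_fun h φ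
  β'_ne φ hφ h := hφ (LinearMap.ext fun v => LinearMap.congr_fun h v)
  exists_mem_ker := exists_ne_zero_mem_ker hV
  exists_mem_ker' := exists_ne_zero_mem_ker (by rwa [Subspace.dual_finrank_eq])

/-- The sign leaves the identity coefficients unchanged, so it disappears from the left action on
every layer of the filtration. -/
lemma koszulSign_eq (t : ℤ) (x : SphAlg g) : koszulSign (grading g) t x =
    ⟨x.idX, x.idY, x.hXY, (t.negOnePow : ℤ) • x.hYX, (t.negOnePow : ℤ) • x.xiX,
      (t.negOnePow : ℤ) • x.xiY⟩ := by
  have hx : x = (part0 g x : SphAlg g) + (part1 g x : SphAlg g) := by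
    ext <;> simp [part0, part1]
  conv_lhs => rw [hx]
  rw [map_add, koszulSign_apply _ t (part0 g x).2, koszulSign_apply _ t (part1 g x).2]
  rcases Int.even_or_odd t with ht | ht
  · simp [Int.negOnePow_even _ ht]
    ext <;> simp [part0, part1]
  · simp [Int.negOnePow_odd _ ht]
    ext <;> simp [part0, part1]

lemma selfBimodule_left (t : ℤ) (x m : SphAlg g) :
    (selfBimodule (grading g) t).left x m = koszulSign (grading g) t x * m := rfl

lemma selfBimodule_right (t : ℤ) (x m : SphAlg g) :
    (selfBimodule (grading g) t).right x m = m * x := rfl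

lemma mem_selfBimodule_gr {t e : ℤ} {m : SphAlg g} :
    m ∈ (selfBimodule (grading g) t).gr e ↔ m ∈ grading g (e + t) := Iff.rfl

/-- The filtration of `SphAlg g` by its radical powers, refined by components: if the cocycles
can be corrected in their identity components, and the remaining simple subquotients are
acyclic, then `SphAlg g` is acyclic. -/
theorem acyclic_of_components (t : ℤ) (s : ℕ)
    (hX : ∀ f ∈ (selfBimodule (grading g) t).homogeneous s,
      (selfBimodule (grading g) t).d s f = 0 →
      (GradedBimodule.ofCharacters (charX g) (charX g) (-t) k).d s
        ((charX g).toLinearMap.compMultilinearMap f) = 0 →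
      (charX g).toLinearMap.compMultilinearMap f ∈
        (GradedBimodule.ofCharacters (charX g) (charX g) (-t) k).coboundaries s)
    (hY : ∀ f ∈ (selfBimodule (grading g) t).homogeneous s,
      (selfBimodule (grading g) t).d s f = 0 →
      (GradedBimodule.ofCharacters (charY g) (charY g) (-t) k).d s
        ((charY g).toLinearMap.compMultilinearMap f) = 0 →
      (charY g).toLinearMap.compMultilinearMap f ∈
        (GradedBimodule.ofCharacters (charY g) (charY g) (-t) k).coboundaries s)
    (hXY : (GradedBimodule.ofCharacters (charY g) (charX g) (-t) V).Acyclic s)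
    (hYX : (GradedBimodule.ofCharacters (charX g) (charY g) (1 - t) (Module.Dual k V)).Acyclic s)
    (hxX : (GradedBimodule.ofCharacters (charX g) (charX g) (1 - t) k).Acyclic s)
    (hxY : (GradedBimodule.ofCharacters (charY g) (charY g) (1 - t) k).Acyclic s) :
    (selfBimodule (grading g) t).Acyclic s := by
  suffices h : (selfBimodule (grading g) t).AcyclicOn ⊤ s from
    fun f hf hdf => h f hf hdf fun _ => trivial
  -- The identity coefficients are multiplicative on the whole algebra, so they are removed first.
  refine GradedBimodule.acyclicOn_of_inf_ker _
    (GradedBimodule.ofCharacters (charX g) (charX g) (-t) k) _ ?_ ?_ (charX g).toLinearMap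
    (fromX g ∘ₗ LinearMap.inl k k (V × k)) ?_ ?_ ?_ ?_ ?_
    (fun f hf hdf _ => hX f hf hdf) ?_
  · simp
  · simp
  · simp
  · intro e m hm
    rw [mem_selfBimodule_gr, mem_grading]
    rw [GradedBimodule.mem_ofCharacters_gr] at hm
    simp only [LinearMap.comp_apply, LinearMap.inl_apply, fromX_apply]
    exact ⟨fun h => by simp [hm (by lia)], fun h => by simp⟩
  · simp [fromX_apply]
  · simp [selfBimodule_left, koszulSign_eq]
  · simp [selfBimodule_right, mul_comm]
  refine GradedBimodule.acyclicOn_of_inf_ker _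
    (GradedBimodule.ofCharacters (charY g) (charY g) (-t) k) _ ?_ ?_ (charY g).toLinearMap
    (fromY g ∘ₗ LinearMap.inl k k (Module.Dual k V × k)) ?_ ?_ ?_ ?_ ?_
    (fun f hf hdf _ => hY f hf hdf) ?_
  · simp +contextual [selfBimodule_left, koszulSign_eq]
  · simp +contextual [selfBimodule_right]
  · simp [fromY_apply]
  · intro e m hm
    rw [mem_selfBimodule_gr, mem_grading]
    rw [GradedBimodule.mem_ofCharacters_gr] at hm
    simp only [LinearMap.comp_apply, LinearMap.inl_apply, fromY_apply]
    exact ⟨fun h => by simp [hm (by lia)], fun h => by simp⟩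
  · simp [fromY_apply]
  · simp [selfBimodule_left, koszulSign_eq]
  · simp [selfBimodule_right, mul_comm]
  -- The arrow components become compatible with the actions once the identity components vanish.
  refine GradedBimodule.acyclicOn_of_inf_ker _
    (GradedBimodule.ofCharacters (charY g) (charX g) (-t) V) _ ?_ ?_ (lhXY g)
    (fromX g ∘ₗ LinearMap.inr k k (V × k) ∘ₗ LinearMap.inl k V k) ?_ ?_ ?_ ?_ ?_
    (fun f hf _ _ h => hXY _ (GradedBimodule.comp_mem_homogeneous ?_ hf) h) ?_
  · simp +contextual [selfBimodule_left, koszulSign_eq]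
  · simp +contextual [selfBimodule_right]
  · simp [fromX_apply]
  · intro e m hm
    rw [mem_selfBimodule_gr, mem_grading]
    rw [GradedBimodule.mem_ofCharacters_gr] at hm
    simp only [LinearMap.comp_apply, LinearMap.inl_apply, LinearMap.inr_apply, fromX_apply]
    exact ⟨fun h => by simp [hm (by lia)], fun h => by simp⟩
  · simp [fromX_apply]
  · simp +contextual [selfBimodule_left, koszulSign_eq]
  · simp +contextual [selfBimodule_right]
  · intro e m hm
    rw [mem_selfBimodule_gr, mem_grading] at hm
    rw [GradedBimodule.mem_ofCharacters_gr]
    exact fun h => (hm.1 (by lia)).2.2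
  refine GradedBimodule.acyclicOn_of_inf_ker _
    (GradedBimodule.ofCharacters (charX g) (charY g) (1 - t) (Module.Dual k V)) _ ?_ ?_ (lhYX g)
    (fromY g ∘ₗ LinearMap.inr k k (Module.Dual k V × k) ∘ₗ LinearMap.inl k (Module.Dual k V) k)
    ?_ ?_ ?_ ?_ ?_
    (fun f hf _ _ h => hYX _ (GradedBimodule.comp_mem_homogeneous ?_ hf) h) ?_
  · simp +contextual [selfBimodule_left, koszulSign_eq]
  · simp +contextual [selfBimodule_right]
  · simp [fromY_apply]
  · intro e m hm
    rw [mem_selfBimodule_gr, mem_grading]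
    rw [GradedBimodule.mem_ofCharacters_gr] at hm
    simp only [LinearMap.comp_apply, LinearMap.inl_apply, LinearMap.inr_apply, fromY_apply]
    exact ⟨fun h => by simp, fun h => by simp [hm (by lia)]⟩
  · simp [fromY_apply]
  · simp +contextual [selfBimodule_left, koszulSign_eq]
  · simp +contextual [selfBimodule_right]
  · intro e m hm
    rw [mem_selfBimodule_gr, mem_grading] at hm
    rw [GradedBimodule.mem_ofCharacters_gr]
    exact fun h => (hm.2 (by lia)).1
  -- Likewise the $\xi$ components, once the identity and arrow components vanish; they form the
  -- socle.
  refine GradedBimodule.acyclicOn_of_inf_ker _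
    (GradedBimodule.ofCharacters (charX g) (charX g) (1 - t) k) _ ?_ ?_ (lxiX g)
    (fromX g ∘ₗ LinearMap.inr k k (V × k) ∘ₗ LinearMap.inr k V k) ?_ ?_ ?_ ?_ ?_
    (fun f hf _ _ h => hxX _ (GradedBimodule.comp_mem_homogeneous ?_ hf) h) ?_
  · simp +contextual [selfBimodule_left, koszulSign_eq]
  · simp +contextual [selfBimodule_right]
  · simp [fromX_apply]
  · intro e m hm
    rw [mem_selfBimodule_gr, mem_grading]
    rw [GradedBimodule.mem_ofCharacters_gr] at hm
    simp only [LinearMap.comp_apply, LinearMap.inr_apply, fromX_apply]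
    exact ⟨fun h => by simp, fun h => by simp [hm (by lia)]⟩
  · simp [fromX_apply]
  · simp +contextual [selfBimodule_left, koszulSign_eq]
  · simp +contextual [selfBimodule_right, mul_comm]
  · intro e m hm
    rw [mem_selfBimodule_gr, mem_grading] at hm
    rw [GradedBimodule.mem_ofCharacters_gr]
    exact fun h => (hm.2 (by lia)).2.1
  refine GradedBimodule.acyclicOn_of_inf_ker _
    (GradedBimodule.ofCharacters (charY g) (charY g) (1 - t) k) _ ?_ ?_ (lxiY g)
    (fromY g ∘ₗ LinearMap.inr k k (Module.Dual k V × k) ∘ₗ LinearMap.inr k (Module.Dual k V) k)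
    ?_ ?_ ?_ ?_ ?_
    (fun f hf _ _ h => hxY _ (GradedBimodule.comp_mem_homogeneous ?_ hf) h) ?_
  · simp +contextual [selfBimodule_left, koszulSign_eq]
  · simp +contextual [selfBimodule_right]
  · simp [fromY_apply]
  · intro e m hm
    rw [mem_selfBimodule_gr, mem_grading]
    rw [GradedBimodule.mem_ofCharacters_gr] at hm
    simp only [LinearMap.comp_apply, LinearMap.inr_apply, fromY_apply]
    exact ⟨fun h => by simp, fun h => by simp [hm (by lia)]⟩
  · simp [fromY_apply]
  · simp +contextual [selfBimodule_left, koszulSign_eq]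
  · simp +contextual [selfBimodule_right, mul_comm]
  · intro e m hm
    rw [mem_selfBimodule_gr, mem_grading] at hm
    rw [GradedBimodule.mem_ofCharacters_gr]
    exact fun h => (hm.2 (by lia)).2.2
  intro f hf hdf hW
  have : f = 0 := by
    ext1 a
    have h := hW a
    simp only [Submodule.mem_inf, LinearMap.mem_ker] at h
    obtain ⟨⟨⟨⟨⟨⟨-, h1⟩, h2⟩, h3⟩, h4⟩, h5⟩, h6⟩ := h
    exact SphAlg.ext h1 h2 h3 h4 h5 h6
  rw [this]
  exact zero_mem _

end SphAlg

namespace SphAlg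

open Hochschild

/-! ### Linear algebra of the relations imposed by the cocycle equation. -/

section Relations

variable {k : Type*} [Field k]

/-- With three indices available, one can choose them so that most Kronecker deltas vanish. This
first makes $Q$ diagonal, then $P$ and $L$, and finally compares the diagonal entries. -/
lemma exists_scalar_of_three_le {n : ℕ} (hn : 3 ≤ n) {g : Matrix (Fin n) (Fin n) k}
    (hg : ∀ v, g.mulVec v = 0 → v = 0) {M L P Q : Fin n → Fin n → k}
    (h : ∀ i j a b, (if b = i then M a j else 0) + Q b i * g a j =
      (if b = j then L a i else 0) + (if a = i then P b j else 0)) :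
    (∃ c, ∀ a j, M a j = c * g a j) ∧ ∃ c, ∀ a i, L a i = if a = i then c else 0 := by
  have third (i j : Fin n) : ∃ l, l ≠ i ∧ l ≠ j := by
    have : (({i, j} : Finset (Fin n))ᶜ).Nonempty := by
      rw [← Finset.card_pos, Finset.card_compl, Fintype.card_fin]
      have := Finset.card_le_two (a := i) (b := j)
      lia
    obtain ⟨l, hl⟩ := this
    simp only [Finset.mem_compl, Finset.mem_insert, Finset.mem_singleton, not_or] at hl
    exact ⟨l, hl⟩
  have col (j : Fin n) : ∃ a, g a j ≠ 0 := by
    by_contra! hc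
    have := hg (Pi.single j 1) (by ext a; simp [hc])
    simpa using congrFun this j
  have hQ {b i : Fin n} (hbi : b ≠ i) : Q b i = 0 := by
    by_contra hne
    have hz {a j : Fin n} (ha : a ≠ i) (hj : j ≠ b) : g a j = 0 := by
      have := h i j a b
      rw [if_neg hbi, if_neg hj.symm, if_neg ha] at this
      simpa [hne] using this
    obtain ⟨l, hlb, hli⟩ := third b i
    -- If $Q_{bi}\ne0$, all columns of $g$ other than column $b$ are supported in row $i$. Columns
    -- $i$ and $l$ are then proportional, and this vector is the resulting kernel element.
    have hv := hg (Pi.single i (g i l) - Pi.single l (g i i)) (by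
      ext a
      rw [Matrix.mulVec_sub]
      by_cases ha : a = i
      · subst ha
        simp [mul_comm]
      · simp [hz ha hbi.symm, hz ha hlb])
    have h1 : g i l = 0 := by simpa [hli.symm] using congrFun hv i
    obtain ⟨a, ha⟩ := col l
    by_cases hai : a = i
    · exact ha (hai ▸ h1)
    · exact ha (hz hai hlb)
  have hP {b j : Fin n} (hbj : b ≠ j) : P b j = 0 := by
    obtain ⟨l, hl, -⟩ := third b b
    have := h l j l b
    rw [if_neg hl.symm, if_neg hbj, if_pos rfl, hQ hl.symm] at this
    simpa using this.symm
  have hL {a i : Fin n} (hai : a ≠ i) : L a i = 0 := by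
    obtain ⟨l, hl, -⟩ := third i i
    have := h i l a l
    rw [if_neg hl, if_pos rfl, if_neg hai, hQ hl] at this
    simpa using this.symm
  have hLP {i b : Fin n} (hib : i ≠ b) : L i i = -P b b := by
    have := h i b i b
    rw [if_neg hib.symm, if_pos rfl, if_pos rfl, hQ hib.symm] at this
    linear_combination -this
  have hMQ {i j : Fin n} (hij : i ≠ j) (a : Fin n) : M a j = -Q i i * g a j := by
    have := h i j a i
    rw [if_pos rfl, if_neg hij, hP hij, ite_self] at this
    linear_combination this
  have hQQ (i i' : Fin n) : Q i i = Q i' i' := by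
    obtain ⟨l, hl, hl'⟩ := third i i'
    obtain ⟨a, ha⟩ := col l
    have h1 := hMQ hl.symm a
    rw [hMQ hl'.symm a] at h1
    exact (neg_injective (mul_right_cancel₀ ha h1)).symm
  have hLL (i i' : Fin n) : L i i = L i' i' := by
    obtain ⟨l, hl, hl'⟩ := third i i'
    rw [hLP hl.symm, hLP hl'.symm]
  let o : Fin n := ⟨0, by lia⟩
  refine ⟨⟨-Q o o, fun a j => ?_⟩, L o o, fun a i => ?_⟩
  · obtain ⟨l, hl, -⟩ := third j j
    rw [hMQ hl, hQQ l o]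
  · by_cases hai : a = i
    · rw [if_pos hai, hai, hLL i o]
    · rw [if_neg hai, hL hai]

/-- For nonscalar $g$ the first family of relations already makes $Q$ scalar. For scalar $g$ the
second family is needed and gives this only up to a factor 2. -/
lemma exists_scalar_of_two {g : Matrix (Fin 2) (Fin 2) k}
    (hg : ∀ v, g.mulVec v = 0 → v = 0) {M L P Q P' Q' : Fin 2 → Fin 2 → k}
    (h : ∀ i j a b, (if b = i then M a j else 0) + Q b i * g a j =
      (if b = j then L a i else 0) + (if a = i then P b j else 0))
    (h' : ∀ i j a b, (if a = i then L b j else 0) + (if b = i then M a j else 0) + g a j * P' i b =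
      if b = j then Q' i a else 0)
    (hchar : (∀ c : kˣ, g ≠ (c : k) • 1) ∨ ringChar k ≠ 2) :
    (∃ c, ∀ a j, M a j = c * g a j) ∧ ∃ c, ∀ a i, L a i = if a = i then c else 0 := by
  have a1 := h 0 0 0 0
  have a2 := h 0 1 0 0
  have a3 := h 0 0 1 0
  have a4 := h 0 1 1 0
  have b1 := h 1 0 0 1
  have b2 := h 1 1 0 1
  have b3 := h 1 0 1 1
  have b4 := h 1 1 1 1
  have c1 := h 0 0 0 1
  have c2 := h 0 1 0 1
  have c3 := h 0 0 1 1
  have c4 := h 0 1 1 1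
  have d1 := h 1 0 0 0
  have d2 := h 1 1 0 0
  have d3 := h 1 0 1 0
  have d4 := h 1 1 1 0
  simp only [Fin.isValue, if_true, zero_ne_one, one_ne_zero, if_false, zero_add, add_zero]
    at a1 a2 a3 a4 b1 b2 b3 b4 c1 c2 c3 c4 d1 d2 d3 d4
  -- Everything reduces to $Q$ being scalar.
  have main (h01 : Q 0 1 = 0) (h10 : Q 1 0 = 0) (hd : Q 0 0 = Q 1 1) :
      (∃ c, ∀ a j, M a j = c * g a j) ∧ ∃ c, ∀ a i, L a i = if a = i then c else 0 := by
    rw [h01] at d1 d3 d4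
    rw [h10] at c1 c2 c4
    rw [hd] at a1 a2 a3 a4
    refine ⟨⟨-Q 1 1, ?_⟩, L 0 0, ?_⟩ <;>
      simp only [Fin.forall_fin_two, Fin.isValue, if_true, zero_ne_one, one_ne_zero, if_false]
    · refine ⟨⟨?_, ?_⟩, ?_, ?_⟩
      · linear_combination b1
      · linear_combination a2 - d4
      · linear_combination a3 - c4
      · linear_combination a4
    · refine ⟨⟨trivial, ?_⟩, ?_, ?_⟩
      · linear_combination -d1
      · linear_combination -c4
      · linear_combination -d3 + a1 - b1
  -- Eliminating $M$, $L$ and $P$ leaves conditions on $Q$ and $g$ alone: these three, together with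
  -- `c3` and `d2`.
  have r1 : Q 0 1 * (g 1 1 - g 0 0) = (Q 0 0 - Q 1 1) * g 0 1 := by
    linear_combination d4 - d1 - a2 + b2
  have r2 : Q 1 0 * (g 1 1 - g 0 0) = (Q 0 0 - Q 1 1) * g 1 0 := by
    linear_combination c4 - c1 - a3 + b3
  have r3 : (Q 0 0 - Q 1 1) * (g 0 0 - g 1 1) = Q 1 0 * g 0 1 + Q 0 1 * g 1 0 := by
    linear_combination a1 - b1 + b4 - a4 - c2 - d3
  by_cases h01 : g 0 1 = 0
  · by_cases h10 : g 1 0 = 0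
    · by_cases hdiag : g 0 0 = g 1 1
      · have hne : g 0 0 ≠ 0 := by
          intro h0
          have := hg (Pi.single 0 1) (by
            ext a
            fin_cases a
            · simp [h0]
            · simp [h10])
          simpa using congrFun this 0
        -- Here $g$ is a nonzero scalar matrix and `r1`–`r3`, `c3`, `d2` are empty, so the
        -- hypothesis on $g$ or the characteristic has to supply that 2 is invertible.
        have h2 : (2 : k) ≠ 0 := by
          rcases hchar with hc | hc
          · refine absurd ?_ (hc (Units.mk0 _ hne))
            ext a b
            fin_cases a <;> fin_cases b <;> simp [h01, h10, hdiag]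
          · exact Ring.two_ne_zero hc
        have p1 := h' 0 1 0 0
        have p2 := h' 1 0 1 1
        have p3 := h' 0 0 0 0
        have p4 := h' 0 1 1 0
        have p5 := h' 0 1 0 1
        simp only [Fin.isValue, if_true, zero_ne_one, one_ne_zero, if_false, zero_add, add_zero]
          at p1 p2 p3 p4 p5
        refine main ?_ ?_ ?_
        -- The first family gives $L_{01}=g_{00}Q_{01}$ and, as $g_{01}=0$, $M_{01}=g_{11}Q_{01}$;
        -- the second makes their sum zero, which is the source of the factor 2.
        · have : 2 * g 0 0 * Q 0 1 = 0 := by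
            linear_combination p1 - a2 + d4 + d1 + Q 0 1 * hdiag + (Q 0 0 - P' 0 0) * h01
          simpa [h2, hne] using this
        · have : 2 * g 0 0 * Q 1 0 = 0 := by
            linear_combination p2 - b3 + c1 + c4 + Q 1 0 * hdiag + (Q 1 1 - P' 1 1) * h10
          simpa [h2, hne] using this
        · have : 2 * g 0 0 * (Q 0 0 - Q 1 1) = 0 := by
            linear_combination p3 - p4 - p5 + a1 - 2 * b1 + a4 - d3 + (Q 0 0 - P' 0 0) * hdiag +
              P' 0 1 * h01 + Q 0 1 * h10
          simpa [h2, hne, sub_eq_zero] using this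
      · have hne : g 1 1 - g 0 0 ≠ 0 := sub_ne_zero.2 (Ne.symm hdiag)
        have q1 : Q 0 1 = 0 := by simpa [h01, hne] using r1
        have q2 : Q 1 0 = 0 := by simpa [h10, hne] using r2
        refine main q1 q2 ?_
        simpa [q1, q2, sub_eq_zero, hdiag] using r3
    · have q2 : Q 1 0 = 0 := by simpa [h10] using c3
      have q3 : Q 0 0 - Q 1 1 = 0 := by simpa [q2, h10] using r2
      have q1 : Q 0 1 = 0 := by simpa [q2, q3, h10] using r3
      exact main q1 q2 (sub_eq_zero.1 q3)
  · have q1 : Q 0 1 = 0 := by simpa [h01] using d2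
    have q3 : Q 0 0 - Q 1 1 = 0 := by simpa [q1, h01] using r1
    have q2 : Q 1 0 = 0 := by simpa [q1, q3, h01] using r3
    exact main q1 q2 (sub_eq_zero.1 q3)

/-- The linear relations which the cocycle condition imposes on the identity components of a
cocycle with two arguments force them to be multiples of the compositions. -/
lemma exists_scalar {n : ℕ} (hn : 2 ≤ n) {g : Matrix (Fin n) (Fin n) k}
    (hg : ∀ v, g.mulVec v = 0 → v = 0) {M L P Q P' Q' : Fin n → Fin n → k}
    (h : ∀ i j a b, (if b = i then M a j else 0) + Q b i * g a j =
      (if b = j then L a i else 0) + (if a = i then P b j else 0))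
    (h' : ∀ i j a b, (if a = i then L b j else 0) + (if b = i then M a j else 0) + g a j * P' i b =
      if b = j then Q' i a else 0)
    (hchar : 3 ≤ n ∨ (∀ c : kˣ, g ≠ (c : k) • 1) ∨ ringChar k ≠ 2) :
    (∃ c, ∀ a j, M a j = c * g a j) ∧ ∃ c, ∀ a i, L a i = if a = i then c else 0 := by
  rcases hn.lt_or_eq with hn | rfl
  · exact exists_scalar_of_three_le hn hg h
  · exact exists_scalar_of_two hg h h' (hchar.resolve_left (by simp))

end Relations

/-! ### Acyclicity below the diagonal, and the cocycle equation on triples of arrows. -/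

section Vanishing

variable {k V : Type*} [Field k] [AddCommGroup V] [Module k V] {g : V →ₗ[k] V}

/-- In this and the next three lemmas the bound is the length of a path of degree $d$ from the
object of the right character to that of the left one: $2d$ for loops, $2d-1$ from $Y$ to $X$,
$2d+1$ from $X$ to $Y$. -/
lemma acyclic_XX [FiniteDimensional k V] (hg : Function.Injective g)
    (hV : 2 ≤ Module.finrank k V) {s : ℕ} {d : ℤ}
    (h : s < 2 * d) :
    (GradedBimodule.ofCharacters (charX g) (charX g) d k).Acyclic s :=
  ((TwoVertexAlgebra.Target.linear (D := twoVertex hg hV) (χ := charX g) (c := 0) (c' := -1)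
    ⟨rfl, Or.inl ⟨rfl, rfl⟩⟩ s).1.1 d (by lia))

lemma acyclic_XY [FiniteDimensional k V] (hg : Function.Injective g)
    (hV : 2 ≤ Module.finrank k V) {s : ℕ} {d : ℤ}
    (h : s < 2 * d - 1) :
    (GradedBimodule.ofCharacters (charX g) (charY g) d k).Acyclic s :=
  ((TwoVertexAlgebra.Target.linear (D := twoVertex hg hV) (χ := charX g) (c := 0) (c' := -1)
    ⟨rfl, Or.inl ⟨rfl, rfl⟩⟩ s).2.1 d (by lia))

lemma acyclic_YX [FiniteDimensional k V] (hg : Function.Injective g)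
    (hV : 2 ≤ Module.finrank k V) {s : ℕ} {d : ℤ}
    (h : s < 2 * d + 1) :
    (GradedBimodule.ofCharacters (charY g) (charX g) d k).Acyclic s :=
  ((TwoVertexAlgebra.Target.linear (D := twoVertex hg hV) (χ := charY g) (c := 1) (c' := 0)
    ⟨rfl, Or.inr ⟨rfl, rfl⟩⟩ s).1.1 d (by lia))

lemma acyclic_YY [FiniteDimensional k V] (hg : Function.Injective g)
    (hV : 2 ≤ Module.finrank k V) {s : ℕ} {d : ℤ}
    (h : s < 2 * d) :
    (GradedBimodule.ofCharacters (charY g) (charY g) d k).Acyclic s :=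
  ((TwoVertexAlgebra.Target.linear (D := twoVertex hg hV) (χ := charY g) (c := 1) (c' := 0)
    ⟨rfl, Or.inr ⟨rfl, rfl⟩⟩ s).2.1 d (by lia))

lemma charX_comp_mem {t : ℤ} {s : ℕ} {f : BimoduleCochain k (SphAlg g) (SphAlg g) s}
    (hf : f ∈ (selfBimodule (grading g) t).homogeneous s) :
    (charX g).toLinearMap.compMultilinearMap f ∈
      (GradedBimodule.ofCharacters (charX g) (charX g) (-t) k).homogeneous s := by
  refine GradedBimodule.comp_mem_homogeneous (fun e m hm => ?_) hf
  rw [mem_selfBimodule_gr, mem_grading] at hm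
  rw [GradedBimodule.mem_ofCharacters_gr]
  exact fun h => (hm.1 (by lia)).1

lemma charY_comp_mem {t : ℤ} {s : ℕ} {f : BimoduleCochain k (SphAlg g) (SphAlg g) s}
    (hf : f ∈ (selfBimodule (grading g) t).homogeneous s) :
    (charY g).toLinearMap.compMultilinearMap f ∈
      (GradedBimodule.ofCharacters (charY g) (charY g) (-t) k).homogeneous s := by
  refine GradedBimodule.comp_mem_homogeneous (fun e m hm => ?_) hf
  rw [mem_selfBimodule_gr, mem_grading] at hm
  rw [GradedBimodule.mem_ofCharacters_gr]
  exact fun h => (hm.1 (by lia)).2.1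

/-- The identity layers, in degree $-t$, give the sharpest bound $s<-2t$; the other four layers
leave room to spare. -/
theorem acyclic_of_lt [FiniteDimensional k V] (hg : Function.Injective g)
    (hV : 2 ≤ Module.finrank k V) {t : ℤ} {s : ℕ}
    (h : s < -2 * t) : (selfBimodule (grading g) t).Acyclic s :=
  acyclic_of_components t s
    (fun _ hf _ hd => acyclic_XX hg hV (by lia) _ (charX_comp_mem hf) hd)
    (fun _ hf _ hd => acyclic_YY hg hV (by lia) _ (charY_comp_mem hf) hd)
    (GradedBimodule.acyclic_ofCharacters_of_basis (Module.finBasis k V)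
      (acyclic_YX hg hV (by lia)))
    (GradedBimodule.acyclic_ofCharacters_of_basis (Module.finBasis k (Module.Dual k V))
      (acyclic_XY hg hV (by lia)))
    (acyclic_XX hg hV (by lia)) (acyclic_YY hg hV (by lia))

/-- The inclusion of `Hom(X,Y)`. -/
def inclXY (g : V →ₗ[k] V) : V →ₗ[k] SphAlg g :=
  fromX g ∘ₗ LinearMap.inr k k _ ∘ₗ LinearMap.inl k _ k

/-- The inclusion of `Hom(Y,X)`. -/
def inclYX (g : V →ₗ[k] V) : Module.Dual k V →ₗ[k] SphAlg g :=
  fromY g ∘ₗ LinearMap.inr k k _ ∘ₗ LinearMap.inl k _ k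

lemma inclXY_apply (v : V) : inclXY g v = ⟨0, 0, v, 0, 0, 0⟩ := rfl

lemma inclYX_apply (φ : Module.Dual k V) : inclYX g φ = ⟨0, 0, 0, φ, 0, 0⟩ := rfl

lemma inclXY_mul_inclYX (v : V) (φ : Module.Dual k V) :
    inclXY g v * inclYX g φ = φ v • fromY g (0, 0, 1) := by
  ext <;> simp [inclXY_apply, inclYX_apply, fromY_apply]

lemma inclYX_mul_inclXY (v : V) (φ : Module.Dual k V) :
    inclYX g φ * inclXY g v = φ (g v) • fromX g (0, 0, 1) := by
  ext <;> simp [inclXY_apply, inclYX_apply, fromX_apply]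

lemma bilin_cocycle {t : ℤ} {f : BimoduleCochain k (SphAlg g) (SphAlg g) 2}
    (hdf : (selfBimodule (grading g) t).d 2 f = 0) (a b c : SphAlg g) :
    koszulSign (grading g) t a * bilin f b c - bilin f (a * b) c + bilin f a (b * c) -
      bilin f a b * c = 0 := by
  have h := congrArg (fun F => F ![a, b, c]) hdf
  rw [GradedBimodule.d_two] at h
  exact h

/-- The $V$-component of the cocycle equation on $X\to Y\to X\to Y$ ties together the identity
components at both objects; no sign enters because $V$ has degree 0. -/
lemma cocycle_XYX {t : ℤ} {f : BimoduleCochain k (SphAlg g) (SphAlg g) 2}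
    (hdf : (selfBimodule (grading g) t).d 2 f = 0) (v : V) (φ : Module.Dual k V) (v' : V) :
    (bilin f (inclYX g φ) (inclXY g v')).idX • v -
      φ v • (bilin f (fromY g (0, 0, 1)) (inclXY g v')).hXY +
      φ (g v') • (bilin f (inclXY g v) (fromX g (0, 0, 1))).hXY -
      (bilin f (inclXY g v) (inclYX g φ)).idY • v' = 0 := by
  have h := congrArg hXY (bilin_cocycle hdf (inclXY g v) (inclYX g φ) (inclXY g v'))
  rw [inclXY_mul_inclYX, inclYX_mul_inclXY, koszulSign_eq] at h
  simp only [map_smul, LinearMap.smul_apply, sub_eq_add_neg, add_hXY, neg_hXY, smul_hXY, mul_hXY,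
    zero_hXY] at h
  simpa [inclXY_apply, sub_eq_add_neg] using h

/-- The counterpart on $Y\to X\to Y\to X$. The Koszul sign of $\varphi$ now makes the two identity
terms enter with equal signs, whereas in `cocycle_XYX` they are opposite. -/
lemma cocycle_YXY {f : BimoduleCochain k (SphAlg g) (SphAlg g) 2}
    (hdf : (selfBimodule (grading g) (-1)).d 2 f = 0) (φ : Module.Dual k V) (v : V)
    (φ' : Module.Dual k V) :
    (bilin f (inclXY g v) (inclYX g φ')).idY • φ +
      φ (g v) • (bilin f (fromX g (0, 0, 1)) (inclYX g φ')).hYX -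
      φ' v • (bilin f (inclYX g φ) (fromY g (0, 0, 1))).hYX +
      (bilin f (inclYX g φ) (inclXY g v)).idX • φ' = 0 := by
  have h := congrArg hYX (bilin_cocycle hdf (inclYX g φ) (inclXY g v) (inclYX g φ'))
  rw [inclXY_mul_inclYX, inclYX_mul_inclXY, koszulSign_eq] at h
  simp only [map_smul, LinearMap.smul_apply, sub_eq_add_neg, add_hYX, neg_hYX, smul_hYX, mul_hYX,
    zero_hYX] at h
  have h1 : ((-1 : ℤ).negOnePow : ℤ) = -1 := rfl
  have h2 (ψ : Module.Dual k V) :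
      (inclYX g ψ).idX = 0 ∧ (inclYX g ψ).idY = 0 ∧ (inclYX g ψ).hYX = ψ := ⟨rfl, rfl, rfl⟩
  rw [h1, (h2 φ).1, (h2 φ).2.2, (h2 φ').2.1, (h2 φ').2.2] at h
  rw [neg_one_smul, zero_smul, zero_smul] at h
  refine Eq.trans ?_ (neg_eq_zero.2 h)
  module

end Vanishing

/-! ### The borderline case of two arguments and degree $-1$, and the theorem. -/

section Borderline

variable {k : Type*} [Field k] {n : ℕ} {g : Matrix (Fin n) (Fin n) k}

lemma injective_toLin' (hg : ∀ v, g.mulVec v = 0 → v = 0) :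
    Function.Injective (Matrix.toLin' g) :=
  (injective_iff_map_eq_zero _).2 fun v hv => hg v (by simpa using hv)

/-- The identity components of a cocycle with two arguments and of degree `-1` are multiples of
the compositions. -/
lemma exists_scalar_of_cocycle (hn : 2 ≤ n) (hg : ∀ v, g.mulVec v = 0 → v = 0)
    (hchar : 3 ≤ n ∨ (∀ c : kˣ, g ≠ (c : k) • 1) ∨ ringChar k ≠ 2)
    {f : BimoduleCochain k (SphAlg (Matrix.toLin' g)) (SphAlg (Matrix.toLin' g)) 2}
    (hdf : (selfBimodule (grading (Matrix.toLin' g)) (-1)).d 2 f = 0) :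
    (∃ c : k, ∀ φ v, (bilin f (inclYX _ φ) (inclXY _ v)).idX = c * φ (Matrix.toLin' g v)) ∧
    ∃ c : k, ∀ v φ, (bilin f (inclXY _ v) (inclYX _ φ)).idY = c * φ v := by
  obtain ⟨⟨c, hc⟩, c', hc'⟩ := exists_scalar hn hg
    (M := fun a j => (bilin f (inclYX _ (LinearMap.proj a)) (inclXY _ (Pi.single j 1))).idX)
    (L := fun a i => (bilin f (inclXY _ (Pi.single i 1)) (inclYX _ (LinearMap.proj a))).idY)
    (P := fun b j => (bilin f (fromY _ (0, 0, 1)) (inclXY _ (Pi.single j 1))).hXY b)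
    (Q := fun b i => (bilin f (inclXY _ (Pi.single i 1)) (fromX _ (0, 0, 1))).hXY b)
    (P' := fun i b => (bilin f (fromX _ (0, 0, 1)) (inclYX _ (LinearMap.proj b))).hYX
      (Pi.single i 1))
    (Q' := fun i a => (bilin f (inclYX _ (LinearMap.proj a)) (fromY _ (0, 0, 1))).hYX
      (Pi.single i 1))
    (fun i j a b => by
      have h := congrFun (cocycle_XYX hdf (Pi.single i 1) (LinearMap.proj a) (Pi.single j 1)) b
      simp [Pi.single_apply, ite_apply] at h
      linear_combination h)
    (fun i j a b => by
      have h := LinearMap.congr_fun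
        (cocycle_YXY hdf (LinearMap.proj a) (Pi.single j 1) (LinearMap.proj b)) (Pi.single i 1)
      by_cases hbj : b = j
      · subst hbj
        simp [Pi.single_apply] at h
        simp
        linear_combination h
      · simp [Pi.single_apply, hbj] at h
        simp [hbj]
        linear_combination h)
    hchar
  -- The scalars were found in coordinates; comparing bilinear maps on the standard basis and its
  -- dual extends them to all arguments.
  have hb (a : Fin n) : (Pi.basisFun k (Fin n)).dualBasis a = LinearMap.proj a := by
    ext
    simp [Pi.single_apply]
  refine ⟨⟨c, fun φ v => ?_⟩, c', fun v φ => ?_⟩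
  · have h : ((bilin f).compl₁₂ (inclYX _) (inclXY _)).compr₂ (charX _).toLinearMap =
        c • LinearMap.lcomp k k (Matrix.toLin' g) := by
      refine LinearMap.ext_basis (Pi.basisFun k (Fin n)).dualBasis (Pi.basisFun k (Fin n))
        fun a j => ?_
      rw [hb, Pi.basisFun_apply]
      simpa using hc a j
    exact LinearMap.congr_fun₂ h φ v
  · have h : ((bilin f).compl₁₂ (inclXY _) (inclYX _)).compr₂ (charY _).toLinearMap =
        c' • Module.Dual.eval k (Fin n → k) := by
      refine LinearMap.ext_basis (Pi.basisFun k (Fin n)) (Pi.basisFun k (Fin n)).dualBasis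
        fun i a => ?_
      rw [hb, Pi.basisFun_apply]
      simpa [Pi.single_apply] using hc' a i
    exact LinearMap.congr_fun₂ h v φ

/-- For $s=2$, $t=-1$ the bound is missed only by the identity layers, where $2d=2$. There the
scalar relations take its place, the layer at $Y$ being handled by exchanging the objects. -/
theorem acyclic_two (hn : 2 ≤ n) (hg : ∀ v, g.mulVec v = 0 → v = 0)
    (hchar : 3 ≤ n ∨ (∀ c : kˣ, g ≠ (c : k) • 1) ∨ ringChar k ≠ 2) :
    (selfBimodule (grading (Matrix.toLin' g)) (-1)).Acyclic 2 := by
  have hG := injective_toLin' hg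
  have hV : 2 ≤ Module.finrank k (Fin n → k) := by simpa using hn
  refine acyclic_of_components (-1) 2 (fun f hf hdf hd => ?_) (fun f hf hdf hd => ?_)
    (GradedBimodule.acyclic_ofCharacters_of_basis (Module.finBasis k _)
      (acyclic_YX hG hV (by simp)))
    (GradedBimodule.acyclic_ofCharacters_of_basis (Module.finBasis k _)
      (acyclic_XY hG hV (by simp)))
    (acyclic_XX hG hV (by simp)) (acyclic_YY hG hV (by simp))
  · obtain ⟨c, hc⟩ := (exists_scalar_of_cocycle hn hg hchar hdf).1
    exact (twoVertex hG hV).mem_coboundaries_two (charX_comp_mem hf) hd c hc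
  · obtain ⟨c, hc⟩ := (exists_scalar_of_cocycle hn hg hchar hdf).2
    exact (twoVertex hG hV).swap.mem_coboundaries_two (charY_comp_mem hf) hd c hc

end Borderline

end SphAlg

theorem theorem1p5 {k : Type*} [Field k] (n : ℕ) (hn : 2 ≤ n) (g : GL (Fin n) k) :
    (∀ m t : ℤ, t < -m →
      Subsingleton
        (Hochschild.HH (SphAlg.grading (Matrix.toLin' (g : Matrix (Fin n) (Fin n) k))) m t)) ∧
    ((3 ≤ n ∨ (∀ c : kˣ, (g : Matrix (Fin n) (Fin n) k) ≠ (c : k) • 1) ∨ ringChar k ≠ 2) →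
      Subsingleton
        (Hochschild.HH (SphAlg.grading (Matrix.toLin' (g : Matrix (Fin n) (Fin n) k))) 1 (-1))) := by
  have hg : ∀ v, (g : Matrix (Fin n) (Fin n) k).mulVec v = 0 → v = 0 := fun v hv => by
    have h := congrArg ((g⁻¹ : GL (Fin n) k) : Matrix (Fin n) (Fin n) k).mulVec hv
    rwa [Matrix.mulVec_mulVec, Units.inv_mul, Matrix.one_mulVec, Matrix.mulVec_zero] at h
  refine ⟨fun m t hmt => ?_, fun h =>
    Hochschild.subsingleton_cohomology (SphAlg.acyclic_two hn hg h)⟩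
  unfold Hochschild.HH
  split
  · next s hs =>
    have hs' : m - t = s := hs
    -- With $s=m-t$, the assumption $t<-m$ is exactly $s<-2t$.
    exact Hochschild.subsingleton_cohomology (SphAlg.acyclic_of_lt (SphAlg.injective_toLin' hg)
      (by simpa using hn) (by lia))
  · infer_instance
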